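/- Let $0<\nu<1$ and $0<a\le\infty$. Let $f$ be complex analytic in the interval $[0,a]$ (in $[0,\infty)$ if $a=\infty$), i.e. $f$ is the restriction of a complex-valued function of a complex variable, again denoted $f$, that is analytic at every point of the interval. Let $\rho_0\in(0,\infty]$ be the distance from the origin to the singularity of $f$ nearest to it ($\rho_0=\infty$ if $f$ is entire), and let $0<\omega<\min(a,\rho_0)$. If $a=\infty$, assume in addition that the principal value integral on the left-hand side of (1) exists as the limit of the same integral over $[0,b]$ for $b\to\infty$, or that $f(x)x^{-1-\nu}$ is integrable at infinity. Here $\operatorname{PV}\!\int_0^a$ is the Cauchy principal value at $x=\omega$. For finite $a$, the finite part of the integral of $h$ over $[0,a]$, written $\operatorname{f.p.}\!\int_0^a h(x)\,dx$, is $\lim_{\varepsilon\to0^+}C_\varepsilon$, where $\int_\varepsilon^a h(x)\,dx=C_\varepsilon+D_\varepsilon$, $C_\varepsilon$ converges as $\varepsilon\to0^+$, and $D_\varepsilon$ is a finite linear combination of diverging powers $\varepsilon^{-p}$, $p>0$, and of $\ln\varepsilon$. For $a=\infty$, each of the integrals $\operatorname{PV}\!\int_0^\infty$, $\operatorname{f.p.}\!\int_0^\infty$,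 $\int_0^\infty$ is the limit, as $b\to\infty$, of the one over $[0,b]$. Then all the integrals below exist, all the series converge, and $$\operatorname{PV}\!\int_0^a\frac{x^{1-\nu}f(x)}{\omega^2-x^2}\,dx=-\sum_{k=0}^\infty\omega^{2k}\operatorname{f.p.}\!\int_0^a\frac{f(x)}{x^{2k+\nu+1}}\,dx-\frac{\pi}{2\omega^\nu}\left(f(\omega)\cot(\pi\nu)+\frac{f(-\omega)}{\sin(\pi\nu)}\right).\tag{1}$$ If $f$ is even (that is, $f(-x)=f(x)$ for real $|x|<\rho_0$), then $$\operatorname{PV}\!\int_0^a\frac{x^{1-\nu}f(x)}{\omega^2-x^2}\,dx=-\sum_{k=0}^\infty\omega^{2k}\operatorname{f.p.}\!\int_0^a\frac{f(x)}{x^{2k+\nu+1}}\,dx-\frac{\pi}{2}\,\frac{f(\omega)}{\omega^\nu}\cot(\pi\nu/2).\tag{2}$$ If $f(x)=x^mg(x)$ with an integer $m\ge1$ and $g$ analytic at $0$, then $$\begin{aligned}\operatorname{PV}\!\int_0^a\frac{x^{1-\nu}f(x)}{\omega^2-x^2}\,dx=&-\sum_{k=0}^{\lfloor(m-1)/2\rfloor}\omega^{2k}\int_0^ax^{m-2k-\nu-1}g(x)\,dx\\&-\sum_{k=0}^\infty\omega^{2k+2\lfloor(m+1)/2\rfloor}\operatorname{f.p.}\!\int_0^a\frac{x^mg(x)}{x^{2k+2\lfloor(m+1)/2\rfloor+\nu+1}}\,dx\\&-\frac{\pi\omega^{m-\nu}}{2}\left[g(\omega)\cot(\pi\nu)+\frac{(-1)^mg(-\omega)}{\sin(\pi\nu)}\right].\end{aligned}\tag{3}$$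 -/

import Mathlib

open Filter Topology MeasureTheory
open scoped ENNReal

/-- `f` (regarded as a function of a complex variable) is complex analytic in the real interval
`[0, a]`, where `a` is a real number or `∞` (in the latter case the interval is `[0, ∞)`). -/
def ComplexAnalyticUpTo (f : ℂ → ℂ) (a : WithTop ℝ) : Prop :=
  ∀ x : ℝ, 0 ≤ x → (x : WithTop ℝ) ≤ a → AnalyticAt ℂ f (x : ℂ)

/-- Distance from the origin to the nearest singularity of `f`; it is `∞` if `f` is entire. -/
noncomputable def singularityDist (f : ℂ → ℂ) : ℝ≥0∞ :=
  Metric.infEDist (0 : ℂ) {z : ℂ | ¬ AnalyticAt ℂ f z}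

/-- Given a notion `P b L` ("some integral from `0` to the finite number `b` exists and equals
`L`"), the same notion for an upper limit in `(0, ∞]`: over `[0, ∞)` the value is the limit, as
`b → ∞`, of the values over `[0, b]`. -/
def UpperLimit (P : ℝ → ℂ → Prop) : WithTop ℝ → ℂ → Prop
  | (a : ℝ), L => P a L
  | ⊤, L => ∃ v : ℝ → ℂ, (∀ᶠ b in atTop, P b (v b)) ∧ Tendsto v atTop (𝓝 L)

/-- The convergent integral `∫₀ᵃ h(x) dx` exists and equals `L`. -/
def HasIntegral (h : ℝ → ℂ) : WithTop ℝ → ℂ → Prop :=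
  UpperLimit fun a L => IntervalIntegrable h volume 0 a ∧ ∫ x in (0 : ℝ)..a, h x = L

/-- The Cauchy principal value integral `PV ∫₀ᵃ h(x) dx`, with the singularity of `h` at the point
`ω ∈ (0, a)` cut out symmetrically, exists and equals `L`. -/
def HasPVIntegral (h : ℝ → ℂ) (ω : ℝ) : WithTop ℝ → ℂ → Prop :=
  UpperLimit fun a L =>
    (∀ᶠ δ in 𝓝[>] (0 : ℝ),
      IntervalIntegrable h volume 0 (ω - δ) ∧ IntervalIntegrable h volume (ω + δ) a) ∧
    Tendsto (fun δ : ℝ => (∫ x in (0 : ℝ)..(ω - δ), h x) + ∫ x in (ω + δ)..a, h x)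
      (𝓝[>] 0) (𝓝 L)

/-- The finite part of `∫₀ᵃ h(x) dx` (with `h` possibly non-integrable at `0`) exists and
equals `L`. For finite `a` this means `∫_ε^a h = C_ε + D_ε`, where `D_ε` is a linear combination of
finitely many diverging powers `ε ^ (-p)`, `p > 0`, and of `ln ε`, and `C_ε → L` as `ε → 0+`. -/
def HasFinitePart (h : ℝ → ℂ) : WithTop ℝ → ℂ → Prop :=
  UpperLimit fun a L =>
    (∀ᶠ ε in 𝓝[>] (0 : ℝ), IntervalIntegrable h volume ε a) ∧
    ∃ (S : Finset ℝ) (c : ℝ → ℂ) (d : ℂ), (∀ p ∈ S, 0 < p) ∧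
      Tendsto
        (fun ε : ℝ => (∫ x in ε..a, h x) -
          ((∑ p ∈ S, c p * ((ε ^ (-p) : ℝ) : ℂ)) + d * ((Real.log ε : ℝ) : ℂ)))
        (𝓝[>] 0) (𝓝 L)

/-! Expanding the kernel `x ^ (1 - ν) / (ω ^ 2 - x ^ 2)` in powers of `ω / x` and integrating
termwise gives the series of finite parts, but the expansion is only valid for `x > ω`; the
cotangent and sine terms measure the error made below `ω`.

Fix `r` with `ω < r`, `r ≤ a` and `r` inside the disc of analyticity around `0`. On `[0, r]` the
claim, packaged as `HasPVExpansion`, is linear in `f`. Two divided differences, at `ω` and at `-ω`,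
write `f = α + β z + (z ^ 2 - ω ^ 2) h`, so three cases suffice.

For `(z ^ 2 - ω ^ 2) h` (`hasPVExpansion_sq_sub_mul`) the pole cancels, the values at `±ω` vanish,
and the series telescopes to `∫ x ^ (1 - ν) h`. The telescoping needs `ω ^ (2 k)` times the `k`-th
finite part to be summable, which is the growth bound of `exists_hasFinitePart_of_differentiableOn`.

For `1` and `z` the principal value is computed (`hasPVIntegral_pow`): geometric series in `x / ω`
below `ω` and in `ω / x` above it leave two series with logarithmic singularities as the gap closes.
The logarithms cancel, and what remains is the partial fraction expansion of the cotangent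
(`tsum_sub_tsum_eq_cot`).

From `r` to `a` the geometric series converges uniformly on compact intervals and is integrated
termwise (`hasSum_integral_geometric`). When `a = ∞`, either hypothesis at infinity makes `∫ f x ^
(-1 - ν)` converge; integration by parts (`exists_norm_integral_div_pow_le`) bounds the `k`-th tail
by `M / r ^ (2 k)` uniformly in the upper limit, so dominated convergence for series applies. The
even case is a half-angle identity. For `f = x ^ m g` the first terms of the same series are
convergent integrals, by uniqueness of the finite part. -/

/-! ### Finite parts: linearity, powers, uniqueness. -/

lemma hasFinitePart_coe {h : ℝ → ℂ} {b : ℝ} {L : ℂ} :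
    HasFinitePart h (b : WithTop ℝ) L ↔
    (∀ᶠ ε in 𝓝[>] (0 : ℝ), IntervalIntegrable h volume ε b) ∧
    ∃ (S : Finset ℝ) (c : ℝ → ℂ) (d : ℂ), (∀ p ∈ S, 0 < p) ∧
      Tendsto
        (fun ε : ℝ => (∫ x in ε..b, h x) -
          ((∑ p ∈ S, c p * ((ε ^ (-p) : ℝ) : ℂ)) + d * ((Real.log ε : ℝ) : ℂ)))
        (𝓝[>] 0) (𝓝 L) := Iff.rfl

lemma hasPVIntegral_coe {h : ℝ → ℂ} {b ω : ℝ} {L : ℂ} :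
    HasPVIntegral h ω (b : WithTop ℝ) L ↔
    (∀ᶠ δ in 𝓝[>] (0 : ℝ),
      IntervalIntegrable h volume 0 (ω - δ) ∧ IntervalIntegrable h volume (ω + δ) b) ∧
    Tendsto (fun δ : ℝ => (∫ x in (0 : ℝ)..(ω - δ), h x) + ∫ x in (ω + δ)..b, h x)
      (𝓝[>] 0) (𝓝 L) := Iff.rfl

lemma eventually_mem_Ioo_zero {b : ℝ} (hb : 0 < b) : ∀ᶠ ε in 𝓝[>] (0 : ℝ), ε ∈ Set.Ioo 0 b :=
  Ioo_mem_nhdsGT hb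

lemma HasFinitePart.congr {h h' : ℝ → ℂ} {b : ℝ} (hb : 0 < b) {L : ℂ}
    (H : HasFinitePart h (b : WithTop ℝ) L) (heq : ∀ x ∈ Set.Ioc 0 b, h x = h' x) :
    HasFinitePart h' (b : WithTop ℝ) L := by
  rw [hasFinitePart_coe] at H ⊢
  obtain ⟨h1, S, c, d, hS, ht⟩ := H
  have sub : ∀ ε ∈ Set.Ioo 0 b, Set.EqOn h h' (Set.uIoc ε b) := by
    intro ε hε x hx
    rw [Set.uIoc_of_le hε.2.le] at hx
    exact heq x ⟨hε.1.trans hx.1, hx.2⟩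
  refine ⟨?_, S, c, d, hS, ?_⟩
  · filter_upwards [h1, eventually_mem_Ioo_zero hb] with ε h1 hε
    exact h1.congr (sub ε hε)
  · refine ht.congr' ?_
    filter_upwards [eventually_mem_Ioo_zero hb] with ε hε
    congr 1
    exact intervalIntegral.integral_congr_ae (Eventually.of_forall fun x hx => sub ε hε hx)

lemma HasFinitePart.add {h h' : ℝ → ℂ} {b : ℝ} {L L' : ℂ}
    (H : HasFinitePart h (b : WithTop ℝ) L) (H' : HasFinitePart h' (b : WithTop ℝ) L') :
    HasFinitePart (fun x => h x + h' x) (b : WithTop ℝ) (L + L') := by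
  classical
  rw [hasFinitePart_coe] at H H' ⊢
  obtain ⟨h1, S, c, d, hS, ht⟩ := H
  obtain ⟨h1', S', c', d', hS', ht'⟩ := H'
  refine ⟨?_, S ∪ S', fun p => (if p ∈ S then c p else 0) + (if p ∈ S' then c' p else 0),
    d + d', ?_, ?_⟩
  · filter_upwards [h1, h1'] with ε h1 h1' using h1.add h1'
  · intro p hp
    rcases Finset.mem_union.1 hp with h | h
    exacts [hS p h, hS' p h]
  · refine (ht.add ht').congr' ?_
    filter_upwards [h1, h1'] with ε h1 h1'
    rw [intervalIntegral.integral_add h1 h1']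
    have e1 : ∑ p ∈ S ∪ S', (if p ∈ S then c p else 0) * ((ε ^ (-p) : ℝ) : ℂ)
        = ∑ p ∈ S, c p * ((ε ^ (-p) : ℝ) : ℂ) := by
      simp only [ite_mul, zero_mul]
      rw [← Finset.sum_filter, Finset.filter_mem_eq_inter, Finset.inter_eq_right.2
        Finset.subset_union_left]
    have e2 : ∑ p ∈ S ∪ S', (if p ∈ S' then c' p else 0) * ((ε ^ (-p) : ℝ) : ℂ)
        = ∑ p ∈ S', c' p * ((ε ^ (-p) : ℝ) : ℂ) := by
      simp only [ite_mul, zero_mul]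
      rw [← Finset.sum_filter, Finset.filter_mem_eq_inter, Finset.inter_eq_right.2
        Finset.subset_union_right]
    simp only [add_mul, Finset.sum_add_distrib, e1, e2]
    ring

lemma HasFinitePart.const_mul {h : ℝ → ℂ} {b : ℝ} {L : ℂ} (z : ℂ)
    (H : HasFinitePart h (b : WithTop ℝ) L) :
    HasFinitePart (fun x => z * h x) (b : WithTop ℝ) (z * L) := by
  rw [hasFinitePart_coe] at H ⊢
  obtain ⟨h1, S, c, d, hS, ht⟩ := H
  refine ⟨h1.mono fun ε h => h.const_mul z, S, fun p => z * c p, z * d, hS, ?_⟩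
  refine (ht.const_mul z).congr fun ε => ?_
  rw [intervalIntegral.integral_const_mul, mul_sub, mul_add, Finset.mul_sum]
  simp only [mul_assoc]

lemma tendsto_integral_lower {h : ℝ → ℂ} {b : ℝ} (hb : 0 < b)
    (H : IntervalIntegrable h volume 0 b) :
    Tendsto (fun ε : ℝ => ∫ x in ε..b, h x) (𝓝[>] 0) (𝓝 (∫ x in (0 : ℝ)..b, h x)) := by
  have hc := intervalIntegral.continuousOn_primitive_interval_left
    (f := h) (μ := volume) (a := 0) (b := b) (by
      rw [Set.uIcc_of_le hb.le]
      exact (intervalIntegrable_iff_integrableOn_Icc_of_le hb.le).1 H)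
  have := hc 0 Set.left_mem_uIcc
  refine this.mono_left ?_
  rw [Set.uIcc_of_le hb.le]
  exact nhdsWithin_le_iff.2 (mem_of_superset (Ioo_mem_nhdsGT hb) Set.Ioo_subset_Icc_self)

lemma IntervalIntegrable.hasFinitePart {h : ℝ → ℂ} {b : ℝ} (hb : 0 < b)
    (H : IntervalIntegrable h volume 0 b) :
    HasFinitePart h (b : WithTop ℝ) (∫ x in (0 : ℝ)..b, h x) := by
  rw [hasFinitePart_coe]
  refine ⟨?_, ∅, 0, 0, by simp, by simpa using tendsto_integral_lower hb H⟩
  filter_upwards [eventually_mem_Ioo_zero hb] with ε hε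
  refine H.mono_set ?_
  rw [Set.uIcc_of_le hb.le, Set.uIcc_of_le hε.2.le]
  exact Set.Icc_subset_Icc_left hε.1.le

lemma integral_ofReal_rpow {u v q : ℝ} (hu : 0 < u) (hv : 0 < v) (hq : q ≠ 0) :
    ∫ x in u..v, ((x ^ (q - 1) : ℝ) : ℂ) = (((v ^ q - u ^ q) / q : ℝ) : ℂ) := by
  rw [intervalIntegral.integral_ofReal, integral_rpow, sub_add_cancel]
  right
  exact ⟨fun h => hq (by linarith), by simp [Set.mem_uIcc, hu.not_ge, hv.not_ge]⟩

lemma intervalIntegrable_ofReal_rpow {u v : ℝ} (q : ℝ) (hu : 0 < u) (hv : 0 < v) :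
    IntervalIntegrable (fun x : ℝ => ((x ^ q : ℝ) : ℂ)) volume u v := by
  have := (intervalIntegral.intervalIntegrable_rpow (μ := volume) (r := q) (a := u) (b := v)
    (Or.inr (by simp [Set.mem_uIcc, hu.not_ge, hv.not_ge])))
  exact ⟨this.1.ofReal, this.2.ofReal⟩

/-- The lower boundary term `ε ^ q / q` is discarded as divergent when `q < 0` and tends to zero
when `q > 0`, so one value covers both signs. Only `q = 0` would produce a logarithm. -/
lemma hasFinitePart_rpow {b q : ℝ} (hb : 0 < b) (hq : q ≠ 0) :
    HasFinitePart (fun x : ℝ => ((x ^ (q - 1) : ℝ) : ℂ)) (b : WithTop ℝ)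
      ((b ^ q / q : ℝ) : ℂ) := by
  rcases lt_or_gt_of_ne hq with h | h
  · rw [hasFinitePart_coe]
    refine ⟨?_, {-q}, fun _ => -(1 / q : ℂ), 0, by simpa using h, ?_⟩
    · filter_upwards [eventually_mem_Ioo_zero hb] with ε hε
      exact intervalIntegrable_ofReal_rpow _ hε.1 hb
    · refine tendsto_const_nhds.congr' ?_
      filter_upwards [eventually_mem_Ioo_zero hb] with ε hε
      rw [integral_ofReal_rpow hε.1 hb hq]
      simp only [Finset.sum_singleton, neg_neg]
      push_cast
      ring
  · have h1 : IntervalIntegrable (fun x : ℝ => ((x ^ (q - 1) : ℝ) : ℂ)) volume 0 b := by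
      have : IntervalIntegrable (fun x : ℝ => x ^ (q - 1)) volume 0 b :=
        intervalIntegral.intervalIntegrable_rpow' (by linarith)
      exact ⟨this.1.ofReal, this.2.ofReal⟩
    have h2 := h1.hasFinitePart hb
    rw [intervalIntegral.integral_ofReal, integral_rpow (Or.inl (by linarith)), sub_add_cancel,
      Real.zero_rpow hq, sub_zero] at h2
    exact h2

lemma HasFinitePart.extend {h : ℝ → ℂ} {r b : ℝ} {L : ℂ}
    (H : HasFinitePart h (r : WithTop ℝ) L) (hi : IntervalIntegrable h volume r b) :
    HasFinitePart h (b : WithTop ℝ) (L + ∫ x in r..b, h x) := by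
  rw [hasFinitePart_coe] at H ⊢
  obtain ⟨h1, S, c, d, hS, ht⟩ := H
  refine ⟨h1.mono fun ε h => h.trans hi, S, c, d, hS, ?_⟩
  refine (ht.add_const (∫ x in r..b, h x)).congr' ?_
  filter_upwards [h1] with ε h1
  rw [← intervalIntegral.integral_add_adjacent_intervals h1 hi]
  ring

lemma tendsto_rpow_nhdsGT_zero {q : ℝ} (hq : 0 < q) :
    Tendsto (fun ε : ℝ => ((ε ^ q : ℝ) : ℂ)) (𝓝[>] 0) (𝓝 0) := by
  have h := (Real.continuousAt_rpow_const 0 q (Or.inr hq.le)).tendsto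
  rw [Real.zero_rpow hq.ne'] at h
  have := (Complex.continuous_ofReal.tendsto 0).comp
    (h.mono_left (nhdsWithin_le_nhds (s := Set.Ioi 0)))
  simpa [Function.comp_def] using this

/-- A linear combination of `ε ^ (-p)` (`p > 0`) and `log ε` which converges tends to zero. -/
lemma eq_zero_of_tendsto_divergent (S : Finset ℝ) (hS : ∀ p ∈ S, 0 < p) (c : ℝ → ℂ) (d L : ℂ)
    (ht : Tendsto (fun ε : ℝ => (∑ p ∈ S, c p * ((ε ^ (-p) : ℝ) : ℂ)) +
      d * ((Real.log ε : ℝ) : ℂ)) (𝓝[>] 0) (𝓝 L)) : L = 0 := by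
  induction S using Finset.induction_on_max with
  | empty =>
    simp only [Finset.sum_empty, zero_add] at ht
    by_cases hd : d = 0
    · simp only [hd, zero_mul] at ht
      exact tendsto_nhds_unique ht tendsto_const_nhds
    · exfalso
      have h1 : Tendsto (fun ε : ℝ => ‖((Real.log ε : ℝ) : ℂ)‖) (𝓝[>] 0) atTop := by
        simp only [Complex.norm_real, Real.norm_eq_abs]
        exact tendsto_abs_atBot_atTop.comp Real.tendsto_log_nhdsGT_zero
      have h2 := (ht.const_mul d⁻¹).norm
      refine not_tendsto_nhds_of_tendsto_atTop h1 _ (h2.congr fun ε => ?_)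
      rw [inv_mul_cancel_left₀ hd]
  | insert q S hq ih =>
    have hq0 : 0 < q := hS q (Finset.mem_insert_self q S)
    have hqS : q ∉ S := fun h => lt_irrefl _ (hq q h)
    have hpos : ∀ᶠ ε in 𝓝[>] (0 : ℝ), 0 < ε := self_mem_nhdsWithin
    -- Here `q` is the largest exponent. After multiplication by `ε ^ q` every other term, the
    -- logarithm and the right-hand side tend to zero, leaving the constant `c q`.
    have hc : c q = 0 := by
      have h1 := ht.mul (tendsto_rpow_nhdsGT_zero hq0)
      rw [mul_zero] at h1
      have h2 : Tendsto (fun ε : ℝ => (∑ p ∈ S, c p * ((ε ^ (q - p) : ℝ) : ℂ)) +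
          d * ((Real.log ε * ε ^ q : ℝ) : ℂ)) (𝓝[>] 0) (𝓝 ((∑ p ∈ S, c p * 0) + d * 0)) := by
        refine (tendsto_finsetSum _ fun p hp => ?_).add ?_
        · exact (tendsto_rpow_nhdsGT_zero (sub_pos.2 (hq p hp))).const_mul _
        · refine Tendsto.const_mul _ ?_
          have := (Complex.continuous_ofReal.tendsto 0).comp
            (tendsto_log_mul_rpow_nhdsGT_zero hq0)
          simpa [Function.comp_def] using this
      simp only [mul_zero, Finset.sum_const_zero, add_zero] at h2
      have h3 := h1.sub h2
      rw [sub_zero] at h3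
      refine tendsto_nhds_unique (tendsto_const_nhds (x := c q) (f := 𝓝[>] (0 : ℝ))) (h3.congr' ?_)
      filter_upwards [hpos] with ε hε
      rw [Finset.sum_insert hqS, add_mul, add_mul, Finset.sum_mul]
      have e1 : ∀ p, c p * ((ε ^ (-p) : ℝ) : ℂ) * ((ε ^ q : ℝ) : ℂ)
          = c p * ((ε ^ (q - p) : ℝ) : ℂ) := by
        intro p
        rw [mul_assoc, ← Complex.ofReal_mul, ← Real.rpow_add hε]
        rw [neg_add_eq_sub]
      simp only [e1, sub_self, Real.rpow_zero]
      push_cast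
      ring
    refine ih (fun p hp => hS p (Finset.mem_insert_of_mem hp)) (ht.congr fun ε => ?_)
    rw [Finset.sum_insert hqS, hc, zero_mul, zero_add]

lemma HasFinitePart.unique {h : ℝ → ℂ} {b : ℝ} {L L' : ℂ}
    (H : HasFinitePart h (b : WithTop ℝ) L) (H' : HasFinitePart h (b : WithTop ℝ) L') :
    L = L' := by
  have := H.add (H'.const_mul (-1))
  rw [hasFinitePart_coe] at this
  obtain ⟨-, S, c, d, hS, ht⟩ := this
  simp only [neg_mul, one_mul, add_neg_cancel, intervalIntegral.integral_zero, zero_sub] at ht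
  have := eq_zero_of_tendsto_divergent S hS c d _ (by simpa using ht.neg)
  linear_combination -this

/-- An integrable function has its integral as a finite part, and finite parts are unique. This
turns the leading finite parts of `x ^ m g` into ordinary integrals. -/
lemma HasFinitePart.hasIntegral {h : ℝ → ℂ} {a : WithTop ℝ} {L : ℂ} (ha : 0 < a)
    (hi : ∀ b : ℝ, 0 < b → (b : WithTop ℝ) ≤ a → IntervalIntegrable h volume 0 b)
    (H : HasFinitePart h a L) : HasIntegral h a L := by
  induction a using WithTop.recTopCoe with
  | top =>
    obtain ⟨v, hv, hL⟩ := H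
    refine ⟨v, ?_, hL⟩
    filter_upwards [hv, eventually_gt_atTop 0] with b hb hb0
    exact ⟨hi b hb0 le_top, ((hi b hb0 le_top).hasFinitePart hb0).unique hb⟩
  | coe a =>
    have ha' : 0 < a := by exact_mod_cast ha
    exact ⟨hi a ha' le_rfl, ((hi a ha' le_rfl).hasFinitePart ha').unique H⟩

lemma hasFinitePart_sum {b : ℝ} (hb : 0 < b) (N : ℕ) (h : ℕ → ℝ → ℂ) (L : ℕ → ℂ)
    (H : ∀ n, n < N → HasFinitePart (h n) (b : WithTop ℝ) (L n)) :
    HasFinitePart (fun x => ∑ n ∈ Finset.range N, h n x) (b : WithTop ℝ)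
      (∑ n ∈ Finset.range N, L n) := by
  induction N with
  | zero =>
    simp only [Finset.range_zero, Finset.sum_empty]
    simpa using (IntervalIntegrable.hasFinitePart (h := fun _ => 0) hb intervalIntegrable_const)
  | succ N ih =>
    simp only [Finset.sum_range_succ]
    exact (ih fun n hn => H n (by omega)).add (H N (by omega))

/-! ### Finite parts of analytic functions and their growth in `k`. -/

lemma hasSum_taylor_coeff {f : ℂ → ℂ} {R : ℝ} (hf : DifferentiableOn ℂ f (Metric.ball 0 R)) :
    ∃ c : ℕ → ℂ, ∀ z ∈ Metric.ball (0 : ℂ) R, HasSum (fun n => c n * z ^ n) (f z) := by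
  refine ⟨fun n => (n.factorial : ℂ)⁻¹ * iteratedDeriv n f 0, fun z hz => ?_⟩
  have := Complex.hasSum_taylorSeries_on_ball hf hz
  refine this.congr_fun ?_
  intro n
  simp only [smul_eq_mul, sub_zero]
  ring

/-- The exponents `n - 2 k - ν` are the denominators of the integrated Taylor terms. Since `ν` is
not an integer they stay uniformly away from zero, so no logarithm occurs and the bounds do not
depend on `k`. -/
lemma min_le_abs_sub {ν : ℝ} (hν0 : 0 < ν) (hν1 : ν < 1) (n : ℕ) (k : ℕ) :
    min ν (1 - ν) ≤ |(n : ℝ) - 2 * (k : ℝ) - ν| := by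
  rcases le_or_gt n (2 * k) with h | h
  · have h' : (n : ℝ) ≤ 2 * k := by exact_mod_cast h
    rw [abs_of_nonpos (by linarith)]
    exact (min_le_left _ _).trans (by linarith)
  · have h' : (2 * k : ℝ) + 1 ≤ n := by exact_mod_cast h
    rw [abs_of_nonneg (by linarith)]
    exact (min_le_right _ _).trans (by linarith)

lemma norm_tail_le {c : ℕ → ℂ} {r x : ℝ} (hx0 : 0 < x) (hxr : x ≤ r)
    (hs : Summable fun n => ‖c n‖ * r ^ n) (N : ℕ) {F : ℂ}
    (hF : HasSum (fun n => c n * (x : ℂ) ^ n) F) :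
    ‖F - ∑ n ∈ Finset.range N, c n * (x : ℂ) ^ n‖ ≤ (∑' n, ‖c n‖ * r ^ n) / r ^ N * x ^ N := by
  have hr : 0 < r := hx0.trans_le hxr
  have h1 : HasSum (fun n => c (n + N) * (x : ℂ) ^ (n + N))
      (F - ∑ n ∈ Finset.range N, c n * (x : ℂ) ^ n) := (hasSum_nat_add_iff' N).2 hF
  have h2 : Summable fun n => ‖c (n + N)‖ * r ^ (n + N) := (summable_nat_add_iff N).2 hs
  have h3 : ∀ n, ‖c (n + N) * (x : ℂ) ^ (n + N)‖ ≤ ‖c (n + N)‖ * r ^ (n + N) * (x ^ N / r ^ N) := by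
    intro n
    rw [norm_mul, norm_pow, Complex.norm_real, Real.norm_of_nonneg hx0.le, mul_assoc]
    gcongr
    rw [pow_add, pow_add, mul_assoc, mul_div_cancel₀ _ (by positivity)]
    gcongr
  have h4 := h1.norm_le_of_bounded (h2.mul_right _).hasSum h3
  refine h4.trans ?_
  rw [tsum_mul_right]
  have h5 : ∑' n, ‖c (n + N)‖ * r ^ (n + N) ≤ ∑' n, ‖c n‖ * r ^ n := by
    rw [← hs.sum_add_tsum_nat_add N]
    have : 0 ≤ ∑ n ∈ Finset.range N, ‖c n‖ * r ^ n := Finset.sum_nonneg fun n _ => by positivity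
    linarith
  calc _ ≤ (∑' n, ‖c n‖ * r ^ n) * (x ^ N / r ^ N) := by gcongr
    _ = _ := by ring

lemma continuousOn_div_rpow {φ : ℝ → ℂ} {s : Set ℝ} (hφ : ContinuousOn φ s)
    (hs : ∀ x ∈ s, 0 < x) (q : ℝ) :
    ContinuousOn (fun x : ℝ => φ x / ((x ^ q : ℝ) : ℂ)) s := by
  refine hφ.div ?_ ?_
  · exact Complex.continuous_ofReal.comp_continuousOn
      (continuousOn_id.rpow_const fun x hx => Or.inl (hs x hx).ne')
  · intro x hx
    exact_mod_cast (Real.rpow_pos_of_pos (hs x hx) q).ne'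

/-- The Taylor polynomial of degree `2 k` is integrated exactly; the remainder is `O(x ^ (2 k +
1))`, which after division is `O(x ^ (-ν))` and integrable. Both pieces scale like `r ^ (-2 k)` with
a constant independent of `k`, because `∑ ‖c n‖ r ^ n` converges. -/
lemma exists_hasFinitePart_of_differentiableOn {f : ℂ → ℂ} {r R ν : ℝ} (hν0 : 0 < ν) (hν1 : ν < 1)
    (hr : 0 < r) (hrR : r < R) (hf : DifferentiableOn ℂ f (Metric.ball 0 R)) :
    ∃ C : ℝ, ∀ k : ℕ, ∃ J : ℂ, HasFinitePart
      (fun x : ℝ => f (x : ℂ) / ((x ^ (2 * (k : ℝ) + ν + 1) : ℝ) : ℂ)) (r : WithTop ℝ) J ∧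
      ‖J‖ * r ^ (2 * k) ≤ C := by
  obtain ⟨c, hc⟩ := hasSum_taylor_coeff hf
  have hball : ∀ x : ℝ, 0 < x → x ≤ r → (x : ℂ) ∈ Metric.ball (0 : ℂ) R := by
    intro x hx hxr
    simpa [abs_of_pos hx] using hxr.trans_lt hrR
  have hs : Summable fun n => ‖c n‖ * r ^ n := by
    have := (hc r (hball r hr le_rfl)).summable.norm
    simpa [abs_of_pos hr] using this
  set M := ∑' n, ‖c n‖ * r ^ n with hM
  have hM0 : 0 ≤ M := tsum_nonneg fun n => by positivity
  set δ := min ν (1 - ν) with hδ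
  have hδ0 : 0 < δ := lt_min hν0 (by linarith)
  have hfc : ContinuousOn (fun x : ℝ => f (x : ℂ)) (Set.Ioc 0 r) :=
    hf.continuousOn.comp Complex.continuous_ofReal.continuousOn fun x hx => hball x hx.1 hx.2
  -- The first summand bounds the polynomial part, whose denominators are at least `δ`; the second
  -- bounds the remainder through `∫ x ^ (-ν)`.
  refine ⟨r ^ (-ν) * (M / δ) + M * r ^ (-ν) / (1 - ν), fun k => ?_⟩
  have hq : ∀ n : ℕ, (n : ℝ) - 2 * k - ν ≠ 0 := fun n h => by
    have := min_le_abs_sub hν0 hν1 n k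
    rw [h, abs_zero] at this
    linarith
  have hsum := hasFinitePart_sum hr (2 * k + 1)
    (fun n x => c n * ((x ^ ((n : ℝ) - 2 * k - ν - 1) : ℝ) : ℂ)) _
    (fun n _ => (hasFinitePart_rpow hr (hq n)).const_mul (c n))
  set rem : ℝ → ℂ := fun x => f (x : ℂ) / ((x ^ (2 * (k : ℝ) + ν + 1) : ℝ) : ℂ) -
    ∑ n ∈ Finset.range (2 * k + 1), c n * ((x ^ ((n : ℝ) - 2 * k - ν - 1) : ℝ) : ℂ) with hrem
  have hbound : ∀ x ∈ Set.Ioc 0 r, ‖rem x‖ ≤ M / r ^ (2 * k + 1) * x ^ (-ν) := by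
    intro x hx
    have h1 := norm_tail_le hx.1 hx.2 hs (2 * k + 1) (hc x (hball x hx.1 hx.2))
    have hx0 := hx.1
    have hxp : 0 < x ^ (2 * (k : ℝ) + ν + 1) := Real.rpow_pos_of_pos hx.1 _
    have e : rem x = (f x - ∑ n ∈ Finset.range (2 * k + 1), c n * (x : ℂ) ^ n) /
        ((x ^ (2 * (k : ℝ) + ν + 1) : ℝ) : ℂ) := by
      simp only [hrem]
      rw [sub_div, Finset.sum_div]
      refine congrArg _ (Finset.sum_congr rfl fun n _ => ?_)
      rw [mul_div_assoc, ← Complex.ofReal_pow, ← Complex.ofReal_div, ← Real.rpow_natCast,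
        ← Real.rpow_sub hx.1,
        show (n : ℝ) - (2 * (k : ℝ) + ν + 1) = (n : ℝ) - 2 * k - ν - 1 by ring]
    rw [e, norm_div, Complex.norm_real, Real.norm_of_nonneg hxp.le, div_le_iff₀ hxp, mul_assoc,
      ← Real.rpow_add hx.1]
    have : -ν + (2 * (k : ℝ) + ν + 1) = ((2 * k + 1 : ℕ) : ℝ) := by push_cast; ring
    rw [this, Real.rpow_natCast]
    exact h1
  have hbi : IntervalIntegrable (fun x : ℝ => M / r ^ (2 * k + 1) * x ^ (-ν)) volume 0 r :=
    (intervalIntegral.intervalIntegrable_rpow' (by linarith)).const_mul _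
  have hremc : ContinuousOn rem (Set.Ioc 0 r) := by
    refine (continuousOn_div_rpow hfc (fun x hx => hx.1) _).sub ?_
    refine continuousOn_finsetSum _ fun n _ => continuousOn_const.mul ?_
    exact Complex.continuous_ofReal.comp_continuousOn
      (continuousOn_id.rpow_const fun x hx => Or.inl hx.1.ne')
  have hri : IntervalIntegrable rem volume 0 r := by
    rw [intervalIntegrable_iff_integrableOn_Ioc_of_le hr.le] at hbi ⊢
    refine hbi.mono' (hremc.aestronglyMeasurable measurableSet_Ioc) ?_
    exact (ae_restrict_iff' measurableSet_Ioc).2 (Eventually.of_forall hbound)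
  refine ⟨_, (hsum.add (hri.hasFinitePart hr)).congr hr fun x _ => by simp [hrem], ?_⟩
  have hI : ‖∫ x in (0 : ℝ)..r, rem x‖ ≤ M / r ^ (2 * k + 1) * (r ^ (1 - ν) / (1 - ν)) := by
    have := intervalIntegral.norm_integral_le_of_norm_le hr.le
      (Eventually.of_forall fun x hx => hbound x hx) hbi
    rw [intervalIntegral.integral_const_mul, integral_rpow (Or.inl (by linarith))] at this
    rw [show -ν + 1 = 1 - ν by ring, Real.zero_rpow (by linarith), sub_zero] at this
    exact this
  have hS : ‖∑ n ∈ Finset.range (2 * k + 1), c n *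
      ((r ^ ((n : ℝ) - 2 * k - ν) / ((n : ℝ) - 2 * k - ν) : ℝ) : ℂ)‖ ≤
      r ^ (-ν) / r ^ (2 * k) * (M / δ) := by
    calc _ ≤ ∑ n ∈ Finset.range (2 * k + 1), ‖c n‖ * r ^ n * (r ^ (-ν) / r ^ (2 * k) / δ) := by
          refine norm_sum_le_of_le _ fun n _ => ?_
          rw [norm_mul, Complex.norm_real, norm_div, Real.norm_eq_abs, Real.norm_eq_abs,
            abs_of_pos (Real.rpow_pos_of_pos hr _), mul_assoc]
          refine mul_le_mul_of_nonneg_left ?_ (norm_nonneg _)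
          have e : r ^ ((n : ℝ) - 2 * k - ν) = r ^ n * (r ^ (-ν) / r ^ (2 * k)) := by
            rw [show (n : ℝ) - 2 * k - ν = n - (2 * k : ℕ) + -ν by push_cast; ring,
              Real.rpow_add hr, Real.rpow_sub hr, Real.rpow_natCast, Real.rpow_natCast]
            ring
          rw [e, ← mul_div_assoc (r ^ n) _ δ]
          refine div_le_div_of_nonneg_left (by positivity) hδ0 ?_
          exact min_le_abs_sub hν0 hν1 n k
      _ ≤ M * (r ^ (-ν) / r ^ (2 * k) / δ) := by
          rw [← Finset.sum_mul]
          gcongr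
          exact hs.sum_le_tsum _ fun n _ => by positivity
      _ = _ := by ring
  have hpk : 0 < r ^ (2 * k) := by positivity
  calc _ ≤ (r ^ (-ν) / r ^ (2 * k) * (M / δ) + M / r ^ (2 * k + 1) * (r ^ (1 - ν) / (1 - ν)))
        * r ^ (2 * k) := by
        gcongr
        exact (norm_add_le _ _).trans (add_le_add hS hI)
    _ = _ := by
        rw [show 1 - ν = 1 + -ν by ring, Real.rpow_add hr, Real.rpow_one, pow_succ]
        have : 1 + -ν ≠ 0 := by linarith
        field_simp

/-! ### Regularised series and the cotangent. -/

/-- Subtracting `1 / (2 k)` leaves a term of order `k ^ (-2)`. At `k = 0` the subtracted term is `1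
/ 0 = 0`, so the term `1 / c` survives. -/
lemma summable_inv_sub_inv (c : ℝ) :
    Summable fun k : ℕ => 1 / (2 * (k : ℝ) + c) - 1 / (2 * (k : ℝ)) := by
  have h2 : Summable fun k : ℕ => |c| / 2 * (1 / (k : ℝ) ^ 2) :=
    (Real.summable_one_div_nat_pow.2 one_lt_two).mul_left _
  refine h2.of_norm_bounded_eventually_nat ?_
  filter_upwards [eventually_ge_atTop (⌈|c|⌉₊ + 1)] with k hk
  have hk' : |c| + 1 ≤ k := by
    have h3 := Nat.le_ceil |c|
    have h4 : ((⌈|c|⌉₊ : ℝ)) + 1 ≤ k := by exact_mod_cast hk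
    linarith
  have hk0 : 0 < (k : ℝ) := by linarith [abs_nonneg c]
  have hp : (k : ℝ) ≤ 2 * k + c := by linarith [neg_abs_le c]
  have hp0 : 0 < 2 * (k : ℝ) + c := hk0.trans_le hp
  rw [div_sub_div _ _ hp0.ne' (by positivity), norm_div, Real.norm_eq_abs, Real.norm_eq_abs,
    abs_of_pos (show 0 < (2 * (k : ℝ) + c) * (2 * k) by positivity)]
  have e : 1 * (2 * (k : ℝ)) - (2 * k + c) * 1 = -c := by ring
  rw [e, abs_neg]
  calc |c| / ((2 * (k : ℝ) + c) * (2 * k)) ≤ |c| / (k * (2 * k)) := by gcongr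
    _ = _ := by field_simp

lemma summable_pow_div {y : ℝ} (hy0 : 0 ≤ y) (hy : y < 1) (c : ℝ) :
    Summable fun k : ℕ => y ^ k / (2 * (k : ℝ) + c) := by
  refine (summable_geometric_of_lt_one hy0 hy).of_norm_bounded_eventually_nat ?_
  filter_upwards [eventually_ge_atTop (⌈|c|⌉₊ + 1)] with k hk
  have hk' : |c| + 1 ≤ k := by
    have h3 := Nat.le_ceil |c|
    have h4 : ((⌈|c|⌉₊ : ℝ)) + 1 ≤ k := by exact_mod_cast hk
    linarith
  have hp : 1 ≤ 2 * (k : ℝ) + c := by linarith [neg_abs_le c, abs_nonneg c]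
  rw [norm_div, Real.norm_of_nonneg (by positivity), Real.norm_of_nonneg (by linarith)]
  exact div_le_self (by positivity) hp

lemma hasSum_pow_div_two_mul {y : ℝ} (hy0 : 0 ≤ y) (hy : y < 1) :
    HasSum (fun k : ℕ => y ^ k / (2 * (k : ℝ))) (-Real.log (1 - y) / 2) := by
  have h := (Real.hasSum_pow_div_log_of_abs_lt_one (by rwa [abs_of_nonneg hy0])).div_const 2
  have := (hasSum_nat_add_iff (f := fun k : ℕ => y ^ k / (2 * (k : ℝ))) 1).1
    (h.congr_fun fun n => by push_cast; field_simp)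
  simpa using this

/-- Abel summation of `∑ y ^ k / (2 k + c)` after removing its logarithmic singularity. -/
lemma tendsto_tsum_pow_div_add_log (c : ℝ) :
    Tendsto (fun y : ℝ => (∑' k : ℕ, y ^ k / (2 * (k : ℝ) + c)) + Real.log (1 - y) / 2)
      (𝓝[<] 1) (𝓝 (∑' k : ℕ, (1 / (2 * (k : ℝ) + c) - 1 / (2 * (k : ℝ))))) := by
  refine (Real.tendsto_tsum_powerSeries_nhdsWithin_lt
    (summable_inv_sub_inv c).hasSum.tendsto_sum_nat).congr' ?_
  filter_upwards [Ioo_mem_nhdsLT (show (0 : ℝ) < 1 by norm_num)] with y hy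
  have h1 := (summable_pow_div hy.1.le hy.2 c).hasSum.sub (hasSum_pow_div_two_mul hy.1.le hy.2)
  rw [show (∑' k : ℕ, y ^ k / (2 * (k : ℝ) + c)) + Real.log (1 - y) / 2 =
    (∑' k : ℕ, y ^ k / (2 * (k : ℝ) + c)) - -Real.log (1 - y) / 2 by ring, ← h1.tsum_eq]
  congr 1
  ext k
  ring

/-- This is the Mittag-Leffler expansion of the cotangent at `s / 2`, with the poles `k ≥ 0` and `k
< 0` collected in separate regularised series. -/
lemma tsum_sub_tsum_eq_cot {s : ℝ} (hs : ∀ n : ℤ, s ≠ 2 * n) :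
    (∑' k : ℕ, (1 / (2 * (k : ℝ) + s) - 1 / (2 * (k : ℝ)))) -
      (∑' k : ℕ, (1 / (2 * (k : ℝ) + (2 - s)) - 1 / (2 * (k : ℝ)))) =
      Real.pi / 2 * Real.cot (Real.pi * (s / 2)) := by
  have hz : ((s / 2 : ℝ) : ℂ) ∈ Complex.integerComplement := by
    rintro ⟨n, hn⟩
    apply hs n
    have : (n : ℝ) = s / 2 := by exact_mod_cast hn
    linarith
  have hz0 : ∀ n : ℤ, s / 2 + n ≠ 0 := fun n h => hs (-n) (by push_cast; linarith)
  have h1 := (Complex.continuous_re.tendsto _).comp (tendsto_logDeriv_euler_cot_sub hz)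
  have h2 : Tendsto (fun N : ℕ => ∑ j ∈ Finset.range N,
      (1 / (s / 2 - (j + 1)) + 1 / (s / 2 + (j + 1)))) atTop
      (𝓝 (Real.pi * Real.cot (Real.pi * (s / 2)) - 1 / (s / 2))) := by
    have e1 : ((Real.pi : ℂ) * Complex.cot (Real.pi * ((s / 2 : ℝ) : ℂ)) - 1 / ((s / 2 : ℝ) : ℂ)).re
        = Real.pi * Real.cot (Real.pi * (s / 2)) - 1 / (s / 2) := by
      rw [← Complex.ofReal_mul, ← Complex.ofReal_cot, ← Complex.ofReal_mul, ← Complex.ofReal_one,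
        ← Complex.ofReal_div, ← Complex.ofReal_sub, Complex.ofReal_re]
    rw [e1] at h1
    refine h1.congr fun N => ?_
    simp only [Function.comp_apply, Complex.re_sum]
    refine Finset.sum_congr rfl fun j _ => ?_
    have : cotTerm ((s / 2 : ℝ) : ℂ) j =
        ((1 / (s / 2 - (j + 1)) + 1 / (s / 2 + (j + 1)) : ℝ) : ℂ) := by
      rw [cotTerm]; push_cast; rfl
    rw [this, Complex.ofReal_re]
  -- The cotangent series pairs `s / 2 ± (j + 1)`, whereas here `s / 2 + k` meets `s / 2 - (k + 1)`.
  -- The offset leaves `1 / (s / 2)` and the vanishing end term `1 / (s / 2 + N)`.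
  have h3 : Tendsto (fun N : ℕ => 1 / (s / 2 + (N : ℝ))) atTop (𝓝 0) := by
    simp only [one_div]
    exact tendsto_inv_atTop_zero.comp
      (tendsto_atTop_add_const_left _ _ tendsto_natCast_atTop_atTop)
  have h4 := (summable_inv_sub_inv s).hasSum.tendsto_sum_nat.sub
    (summable_inv_sub_inv (2 - s)).hasSum.tendsto_sum_nat
  have h5 := (((h2.add_const (1 / (s / 2))).sub h3).const_mul (1 / 2))
  refine (tendsto_nhds_unique h4 (h5.congr fun N => ?_)).trans (by ring)
  induction N with
  | zero => simp
  | succ N ih =>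
    simp only [Finset.sum_range_succ] at ih ⊢
    have n1 : s / 2 + (N : ℝ) ≠ 0 := by exact_mod_cast hz0 N
    have n2 : s / 2 + ((N : ℝ) + 1) ≠ 0 := by exact_mod_cast hz0 (N + 1)
    have n3 : s / 2 - ((N : ℝ) + 1) ≠ 0 := by
      have := hz0 (-(N + 1)); push_cast at this; intro h; apply this; linarith
    have e1 : 1 / (2 * (N : ℝ) + s) = 1 / 2 * (1 / (s / 2 + N)) := by
      rw [show 2 * (N : ℝ) + s = 2 * (s / 2 + N) by ring]; field_simp
    have e2 : 1 / (2 * (N : ℝ) + (2 - s)) = -(1 / 2 * (1 / (s / 2 - ((N : ℝ) + 1)))) := by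
      rw [show 2 * (N : ℝ) + (2 - s) = -(2 * (s / 2 - ((N : ℝ) + 1))) by ring, div_neg]; field_simp
    push_cast
    rw [e1, e2]
    linear_combination ih

/-- The factor `t ^ p - 1` vanishes to first order at `1`, which beats the logarithm. It allows the
prefactor `t ^ c` to be dropped in front of the logarithmic singularity. -/
lemma tendsto_rpow_sub_one_mul_log (p : ℝ) :
    Tendsto (fun t : ℝ => (t ^ p - 1) * Real.log (1 - t ^ 2)) (𝓝[<] 1) (𝓝 0) := by
  have hd : Tendsto (fun t : ℝ => (t ^ p - 1) / (t - 1)) (𝓝[<] 1) (𝓝 p) := by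
    have h : HasDerivAt (fun t : ℝ => t ^ p) p 1 := by
      simpa using Real.hasDerivAt_rpow_const (x := 1) (p := p) (Or.inl one_ne_zero)
    have := h.tendsto_slope.mono_left
      (nhdsWithin_mono 1 (fun t (ht : t < 1) => (ne_of_lt ht : t ≠ 1)))
    refine this.congr fun t => ?_
    simp [slope_def_field]
  have hl : Tendsto (fun t : ℝ => Real.log (1 - t) * (1 - t)) (𝓝[<] 1) (𝓝 0) := by
    have h := tendsto_log_mul_rpow_nhdsGT_zero (r := 1) one_pos
    simp only [Real.rpow_one] at h
    refine h.comp ?_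
    refine tendsto_nhdsWithin_iff.2 ⟨?_, ?_⟩
    · have : Tendsto (fun t : ℝ => 1 - t) (𝓝 1) (𝓝 (1 - 1)) := by
        exact (continuous_const.sub continuous_id).tendsto 1
      rw [sub_self] at this
      exact this.mono_left nhdsWithin_le_nhds
    · filter_upwards [self_mem_nhdsWithin] with t ht
      exact sub_pos.2 (Set.mem_Iio.1 ht)
  have hc : Tendsto (fun t : ℝ => (t ^ p - 1) * Real.log (1 + t)) (𝓝[<] 1) (𝓝 0) := by
    have h1 : ContinuousAt (fun t : ℝ => (t ^ p - 1) * Real.log (1 + t)) 1 := by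
      refine ContinuousAt.mul ?_ ?_
      · exact (Real.continuousAt_rpow_const 1 p (Or.inl one_ne_zero)).sub continuousAt_const
      · exact ContinuousAt.log (by fun_prop) (by norm_num)
    have := h1.tendsto
    simp only [Real.one_rpow, sub_self, zero_mul] at this
    exact this.mono_left nhdsWithin_le_nhds
  have := ((hd.mul hl).neg).add hc
  simp only [mul_zero, neg_zero, add_zero] at this
  refine this.congr' ?_
  filter_upwards [Ioo_mem_nhdsLT (show (0 : ℝ) < 1 by norm_num)] with t ht
  have h1 : t - 1 ≠ 0 := by linarith [ht.2]
  rw [show 1 - t ^ 2 = (1 - t) * (1 + t) by ring, Real.log_mul (by linarith [ht.2])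
    (by linarith [ht.1])]
  field_simp
  ring

/-- The two terms are the contributions of the endpoints `ω - δ` and `ω + δ`. Each diverges
logarithmically; the symmetric cut makes the divergences cancel. -/
lemma tendsto_pv_bracket {s ω : ℝ} (hω : 0 < ω) (hs : ∀ n : ℤ, s ≠ 2 * n) :
    Tendsto (fun δ : ℝ =>
      ((ω - δ) / ω) ^ s * (∑' k : ℕ, (((ω - δ) / ω) ^ 2) ^ k / (2 * (k : ℝ) + s)) -
      (ω / (ω + δ)) ^ (2 - s) * (∑' k : ℕ, ((ω / (ω + δ)) ^ 2) ^ k / (2 * (k : ℝ) + (2 - s))))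
      (𝓝[>] 0) (𝓝 (Real.pi / 2 * Real.cot (Real.pi * (s / 2)))) := by
  have hIoo := eventually_mem_Ioo_zero hω
  have hu : Tendsto (fun δ : ℝ => (ω - δ) / ω) (𝓝[>] 0) (𝓝[<] 1) := by
    refine tendsto_nhdsWithin_iff.2 ⟨?_, ?_⟩
    · have h : ContinuousAt (fun δ : ℝ => (ω - δ) / ω) 0 := by fun_prop
      have := h.tendsto
      simp only [sub_zero, div_self hω.ne'] at this
      exact this.mono_left nhdsWithin_le_nhds
    · filter_upwards [hIoo] with δ hδ
      rw [Set.mem_Iio, div_lt_one hω]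
      linarith [hδ.1]
  have hv : Tendsto (fun δ : ℝ => ω / (ω + δ)) (𝓝[>] 0) (𝓝[<] 1) := by
    refine tendsto_nhdsWithin_iff.2 ⟨?_, ?_⟩
    · have h : ContinuousAt (fun δ : ℝ => ω / (ω + δ)) 0 := by
        refine ContinuousAt.div (by fun_prop) (by fun_prop) (by simpa using hω.ne')
      have := h.tendsto
      simp only [add_zero, div_self hω.ne'] at this
      exact this.mono_left nhdsWithin_le_nhds
    · filter_upwards [hIoo] with δ hδ
      rw [Set.mem_Iio, div_lt_one (by linarith [hδ.1])]
      linarith [hδ.1]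
  have hsq : Tendsto (fun t : ℝ => t ^ 2) (𝓝[<] 1) (𝓝[<] 1) := by
    refine tendsto_nhdsWithin_iff.2 ⟨?_, ?_⟩
    · have h := (continuous_pow (M := ℝ) 2).tendsto 1
      rw [one_pow] at h
      exact h.mono_left nhdsWithin_le_nhds
    · filter_upwards [Ioo_mem_nhdsLT (show (0 : ℝ) < 1 by norm_num)] with t ht
      exact pow_lt_one₀ ht.1.le ht.2 two_ne_zero
  have hp : ∀ p : ℝ, Tendsto (fun t : ℝ => t ^ p) (𝓝[<] 1) (𝓝 1) := fun p => by
    have h := (Real.continuousAt_rpow_const 1 p (Or.inl one_ne_zero)).tendsto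
    rw [Real.one_rpow] at h
    exact h.mono_left nhdsWithin_le_nhds
  -- The expression equals `t ^ c` times the series plus `log (1 - t ^ 2) / 2`, split so that each
  -- piece has a known limit.
  have main : ∀ c : ℝ, Tendsto (fun t : ℝ =>
      t ^ c * ((∑' k : ℕ, (t ^ 2) ^ k / (2 * (k : ℝ) + c)) + Real.log (1 - t ^ 2) / 2) -
      (t ^ c - 1) * Real.log (1 - t ^ 2) * (1 / 2)) (𝓝[<] 1)
      (𝓝 (∑' k : ℕ, (1 / (2 * (k : ℝ) + c) - 1 / (2 * (k : ℝ))))) := fun c => by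
    have h := ((hp c).mul ((tendsto_tsum_pow_div_add_log c).comp hsq)).sub
      ((tendsto_rpow_sub_one_mul_log c).mul_const (1 / 2))
    simpa using h
  -- This is the difference of the two logarithms for `t = (ω - δ) / ω` and `t = ω / (ω + δ)`: the
  -- common factor `δ` has cancelled and the quotient tends to `1`.
  have hlog : Tendsto (fun δ : ℝ => Real.log ((2 * ω - δ) * (ω + δ) ^ 2 / (ω ^ 2 * (2 * ω + δ))))
      (𝓝[>] 0) (𝓝 0) := by
    have h : ContinuousAt (fun δ : ℝ =>
        Real.log ((2 * ω - δ) * (ω + δ) ^ 2 / (ω ^ 2 * (2 * ω + δ)))) 0 := by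
      refine ContinuousAt.log (ContinuousAt.div (by fun_prop) (by fun_prop) ?_) ?_
      · rw [add_zero]; positivity
      · rw [add_zero, sub_zero]; positivity
    have := h.tendsto
    rw [add_zero, sub_zero, add_zero, mul_comm (2 * ω), div_self (by positivity),
      Real.log_one] at this
    exact this.mono_left nhdsWithin_le_nhds
  have := (((main s).comp hu).sub ((main (2 - s)).comp hv)).sub (hlog.mul_const (1 / 2))
  rw [tsum_sub_tsum_eq_cot hs, zero_mul, sub_zero] at this
  refine this.congr' ?_
  filter_upwards [hIoo] with δ hδ
  have h1 : 0 < δ := hδ.1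
  have h2 : 0 < ω - δ := by linarith [hδ.2]
  have h3 : 0 < ω + δ := by linarith
  have h4 : 0 < 2 * ω - δ := by linarith
  have e : Real.log ((2 * ω - δ) * (ω + δ) ^ 2 / (ω ^ 2 * (2 * ω + δ))) =
      Real.log (1 - ((ω - δ) / ω) ^ 2) - Real.log (1 - (ω / (ω + δ)) ^ 2) := by
    have e1 : 1 - ((ω - δ) / ω) ^ 2 = δ * (2 * ω - δ) / ω ^ 2 := by field_simp; ring
    have e2 : 1 - (ω / (ω + δ)) ^ 2 = δ * (2 * ω + δ) / (ω + δ) ^ 2 := by field_simp; ring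
    rw [e1, e2, ← Real.log_div (by positivity) (by positivity)]
    congr 1
    field_simp
  simp only [Function.comp_apply]
  rw [e]
  ring

/-! ### Termwise integration of the kernel on either side of `ω`. -/

/-- For `x > ω` the kernel is `-x ^ (-ν - 1) ∑ (ω / x) ^ (2 k)`, dominated by ratio `(ω / u) ^ 2 <
1`. It serves both `[ω + δ, r]` for powers and `[r, b]` for general `f`. -/
lemma hasSum_integral_geometric {φ : ℝ → ℂ} {u b ω ν : ℝ} (hω : 0 < ω) (hu : ω < u) (hub : u ≤ b)
    (hφ : ContinuousOn φ (Set.Icc u b)) :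
    HasSum (fun k : ℕ => (ω : ℂ) ^ (2 * k) *
      ∫ x in u..b, φ x / ((x ^ (2 * (k : ℝ) + ν + 1) : ℝ) : ℂ))
      (-∫ x in u..b, ((x ^ (1 - ν) / (ω ^ 2 - x ^ 2) : ℝ) : ℂ) * φ x) := by
  have hu0 : 0 < u := hω.trans hu
  have hΦ : ContinuousOn (fun x => φ x / ((x ^ (ν + 1) : ℝ) : ℂ)) (Set.Icc u b) :=
    continuousOn_div_rpow hφ (fun x hx => hu0.trans_le hx.1) _
  obtain ⟨B, hB⟩ := isCompact_Icc.exists_bound_of_continuousOn hΦ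
  have hq1 : (ω / u) ^ 2 < 1 := pow_lt_one₀ (by positivity) ((div_lt_one hu0).2 hu) two_ne_zero
  have hterm : ∀ (k : ℕ) (x : ℝ), 0 < x →
      (ω : ℂ) ^ (2 * k) * (φ x / ((x ^ (2 * (k : ℝ) + ν + 1) : ℝ) : ℂ)) =
      (φ x / ((x ^ (ν + 1) : ℝ) : ℂ)) * ((((ω / x) ^ 2) ^ k : ℝ) : ℂ) := by
    intro k x hx
    rw [show 2 * (k : ℝ) + ν + 1 = ((2 * k : ℕ) : ℝ) + (ν + 1) by push_cast; ring,
      Real.rpow_add hx, Real.rpow_natCast, ← pow_mul, div_pow]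
    push_cast
    field_simp
  simp only [← intervalIntegral.integral_const_mul]
  rw [← intervalIntegral.integral_neg]
  refine intervalIntegral.hasSum_integral_of_dominated_convergence
    (fun k _ => B * ((ω / u) ^ 2) ^ k) ?_ ?_ ?_ ?_ ?_
  · intro k
    rw [Set.uIoc_of_le hub]
    refine ContinuousOn.aestronglyMeasurable ?_ measurableSet_Ioc
    exact continuousOn_const.mul (continuousOn_div_rpow (hφ.mono Set.Ioc_subset_Icc_self)
      (fun x hx => hu0.trans hx.1) _)
  · intro k
    refine Eventually.of_forall fun x hx => ?_
    rw [Set.uIoc_of_le hub] at hx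
    have hx0 : 0 < x := hu0.trans hx.1
    rw [hterm k x hx0, norm_mul, Complex.norm_real, Real.norm_of_nonneg (by positivity)]
    have := hB x ⟨hx.1.le, hx.2⟩
    have hx1 := hx.1.le
    have hB0 : 0 ≤ B := (norm_nonneg _).trans this
    gcongr
  · exact Eventually.of_forall fun x _ =>
      (summable_geometric_of_lt_one (by positivity) hq1).mul_left _
  · exact intervalIntegrable_const
  · refine Eventually.of_forall fun x hx => ?_
    rw [Set.uIoc_of_le hub] at hx
    have hx0 : 0 < x := hu0.trans hx.1
    have hωx : ω < x := hu.trans hx.1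
    have hq : (ω / x) ^ 2 < 1 := pow_lt_one₀ (by positivity) ((div_lt_one hx0).2 hωx) two_ne_zero
    have h1 := (Complex.hasSum_ofReal.2 (hasSum_geometric_of_lt_one (by positivity) hq)).mul_left
      (φ x / ((x ^ (ν + 1) : ℝ) : ℂ))
    have e : -(((x ^ (1 - ν) / (ω ^ 2 - x ^ 2) : ℝ) : ℂ) * φ x) =
        φ x / ((x ^ (ν + 1) : ℝ) : ℂ) * (((1 - (ω / x) ^ 2)⁻¹ : ℝ) : ℂ) := by
      have h2 : x ^ (1 - ν) = x ^ 2 / x ^ (ν + 1) := by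
        rw [← Real.rpow_natCast, ← Real.rpow_sub hx0]
        congr 1
        push_cast
        ring
      have h3 : 0 < x ^ 2 - ω ^ 2 := by nlinarith
      have h4 : (1 - (ω / x) ^ 2)⁻¹ = x ^ 2 / (x ^ 2 - ω ^ 2) := by
        field_simp
      rw [h2, h4, show ω ^ 2 - x ^ 2 = -(x ^ 2 - ω ^ 2) by ring, div_neg]
      push_cast
      ring
    rw [e]
    exact h1.congr_fun fun k => hterm k x hx0

lemma hasSum_integral_below {s t ω : ℝ} (hs : 1 < s) (ht : 0 < t) (htω : t < ω) :
    HasSum (fun k : ℕ => ω ^ (s - 2) * ((t / ω) ^ s * (((t / ω) ^ 2) ^ k / (2 * (k : ℝ) + s))))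
      (∫ x in (0 : ℝ)..t, x ^ (s - 1) / (ω ^ 2 - x ^ 2)) := by
  have hω : 0 < ω := ht.trans htω
  have hint : ∀ k : ℕ, ∫ x in (0 : ℝ)..t, x ^ (s - 1 + (2 * k : ℕ)) * (ω ^ (2 * k + 2))⁻¹ =
      ω ^ (s - 2) * ((t / ω) ^ s * (((t / ω) ^ 2) ^ k / (2 * (k : ℝ) + s))) := by
    intro k
    have hk : (0 : ℝ) ≤ (2 * k : ℕ) := Nat.cast_nonneg _
    have hd : 0 < 2 * (k : ℝ) + s := by positivity
    rw [intervalIntegral.integral_mul_const, integral_rpow (Or.inl (by linarith)),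
      Real.zero_rpow (by linarith), sub_zero,
      show s - 1 + ((2 * k : ℕ) : ℝ) + 1 = s + (2 * k : ℕ) by ring, Real.rpow_add ht,
      Real.rpow_natCast, Real.rpow_sub hω, Real.div_rpow ht.le hω.le, Real.rpow_two, ← pow_mul,
      div_pow, pow_add]
    have : 0 < ω ^ s := Real.rpow_pos_of_pos hω s
    push_cast
    rw [add_comm s]
    field_simp
  have hq1 : (t / ω) ^ 2 < 1 := pow_lt_one₀ (by positivity) ((div_lt_one hω).2 htω) two_ne_zero
  refine HasSum.congr_fun ?_ fun k => (hint k).symm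
  refine intervalIntegral.hasSum_integral_of_dominated_convergence
    (fun k _ => t ^ (s - 1) / ω ^ 2 * ((t / ω) ^ 2) ^ k) ?_ ?_ ?_ ?_ ?_
  · intro k
    rw [Set.uIoc_of_le ht.le]
    refine ContinuousOn.aestronglyMeasurable ?_ measurableSet_Ioc
    exact (continuousOn_id.rpow_const fun x hx => Or.inl hx.1.ne').mul continuousOn_const
  · intro k
    refine Eventually.of_forall fun x hx => ?_
    rw [Set.uIoc_of_le ht.le] at hx
    have hx0 := hx.1
    have hxt := hx.2
    rw [Real.norm_of_nonneg (by positivity), Real.rpow_add hx0, Real.rpow_natCast]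
    calc x ^ (s - 1) * x ^ (2 * k) * (ω ^ (2 * k + 2))⁻¹
        ≤ t ^ (s - 1) * t ^ (2 * k) * (ω ^ (2 * k + 2))⁻¹ := by
          gcongr
      _ = _ := by
          rw [← pow_mul, div_pow, pow_add]
          field_simp
  · exact Eventually.of_forall fun x _ =>
      (summable_geometric_of_lt_one (by positivity) hq1).mul_left _
  · exact intervalIntegrable_const
  · refine Eventually.of_forall fun x hx => ?_
    rw [Set.uIoc_of_le ht.le] at hx
    have hx0 := hx.1
    have hxω : x < ω := hx.2.trans_lt htω
    have hq : (x / ω) ^ 2 < 1 := pow_lt_one₀ (by positivity) ((div_lt_one hω).2 hxω) two_ne_zero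
    have h1 := (hasSum_geometric_of_lt_one (by positivity) hq).mul_left (x ^ (s - 1) / ω ^ 2)
    have h3 : 0 < ω ^ 2 - x ^ 2 := by nlinarith
    have e : x ^ (s - 1) / (ω ^ 2 - x ^ 2) = x ^ (s - 1) / ω ^ 2 * (1 - (x / ω) ^ 2)⁻¹ := by
      have h4 : (1 - (x / ω) ^ 2)⁻¹ = ω ^ 2 / (ω ^ 2 - x ^ 2) := by field_simp
      rw [h4]
      field_simp
    rw [e]
    refine h1.congr_fun fun k => ?_
    rw [Real.rpow_add hx0, Real.rpow_natCast, ← pow_mul, div_pow, pow_add]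
    field_simp

/-! ### Calculus of principal values. -/

lemma HasPVIntegral.add {h h' : ℝ → ℂ} {b ω : ℝ} {L L' : ℂ}
    (H : HasPVIntegral h ω (b : WithTop ℝ) L) (H' : HasPVIntegral h' ω (b : WithTop ℝ) L') :
    HasPVIntegral (fun x => h x + h' x) ω (b : WithTop ℝ) (L + L') := by
  rw [hasPVIntegral_coe] at H H' ⊢
  refine ⟨?_, (H.2.add H'.2).congr' ?_⟩
  · filter_upwards [H.1, H'.1] with δ h1 h2 using ⟨h1.1.add h2.1, h1.2.add h2.2⟩
  · filter_upwards [H.1, H'.1] with δ h1 h2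
    rw [intervalIntegral.integral_add h1.1 h2.1, intervalIntegral.integral_add h1.2 h2.2]
    ring

lemma HasPVIntegral.const_mul {h : ℝ → ℂ} {b ω : ℝ} {L : ℂ} (z : ℂ)
    (H : HasPVIntegral h ω (b : WithTop ℝ) L) :
    HasPVIntegral (fun x => z * h x) ω (b : WithTop ℝ) (z * L) := by
  rw [hasPVIntegral_coe] at H ⊢
  refine ⟨H.1.mono fun δ h => ⟨h.1.const_mul z, h.2.const_mul z⟩, (H.2.const_mul z).congr fun δ => ?_⟩
  rw [intervalIntegral.integral_const_mul, intervalIntegral.integral_const_mul, mul_add]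

lemma HasPVIntegral.extend {h : ℝ → ℂ} {r b ω : ℝ} {L : ℂ}
    (H : HasPVIntegral h ω (r : WithTop ℝ) L) (hi : IntervalIntegrable h volume r b) :
    HasPVIntegral h ω (b : WithTop ℝ) (L + ∫ x in r..b, h x) := by
  rw [hasPVIntegral_coe] at H ⊢
  refine ⟨H.1.mono fun δ h => ⟨h.1, h.2.trans hi⟩, (H.2.add_const (∫ x in r..b, h x)).congr' ?_⟩
  filter_upwards [H.1] with δ h1
  rw [← intervalIntegral.integral_add_adjacent_intervals h1.2 hi]
  ring

lemma HasPVIntegral.congr {h h' : ℝ → ℂ} {b ω : ℝ} (hω : 0 < ω) (hb : ω < b) {L : ℂ}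
    (H : HasPVIntegral h ω (b : WithTop ℝ) L) (heq : ∀ x, 0 < x → x ≠ ω → h x = h' x) :
    HasPVIntegral h' ω (b : WithTop ℝ) L := by
  rw [hasPVIntegral_coe] at H ⊢
  have sub1 : ∀ δ ∈ Set.Ioo 0 ω, Set.EqOn h h' (Set.uIoc 0 (ω - δ)) := by
    intro δ hδ x hx
    rw [Set.uIoc_of_le (by linarith [hδ.2])] at hx
    exact heq x hx.1 (by linarith [hx.2, hδ.1] : x < ω).ne
  have sub2 : ∀ δ ∈ Set.Ioo 0 (b - ω), Set.EqOn h h' (Set.uIoc (ω + δ) b) := by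
    intro δ hδ x hx
    rw [Set.uIoc_of_le (by linarith [hδ.2])] at hx
    have : ω < x := by linarith [hx.1, hδ.1]
    exact heq x (hω.trans this) this.ne'
  refine ⟨?_, H.2.congr' ?_⟩
  · filter_upwards [H.1, eventually_mem_Ioo_zero hω, eventually_mem_Ioo_zero (sub_pos.2 hb)]
      with δ h1 h2 h3
    exact ⟨h1.1.congr (sub1 δ h2), h1.2.congr (sub2 δ h3)⟩
  · filter_upwards [eventually_mem_Ioo_zero hω, eventually_mem_Ioo_zero (sub_pos.2 hb)] with δ h2 h3
    congr 1
    · exact intervalIntegral.integral_congr_ae (Eventually.of_forall fun x hx => sub1 δ h2 hx)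
    · exact intervalIntegral.integral_congr_ae (Eventually.of_forall fun x hx => sub2 δ h3 hx)

lemma IntervalIntegrable.hasPVIntegral {h : ℝ → ℂ} {b ω : ℝ} (hω : 0 < ω) (hb : ω < b)
    (H : IntervalIntegrable h volume 0 b) :
    HasPVIntegral h ω (b : WithTop ℝ) (∫ x in (0 : ℝ)..b, h x) := by
  have hb0 : 0 < b := hω.trans hb
  have hsub : ∀ u v : ℝ, u ∈ Set.Icc 0 b → v ∈ Set.Icc 0 b → IntervalIntegrable h volume u v :=
    fun u v hu hv => H.mono_set (by
      rw [Set.uIcc_of_le hb0.le]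
      exact Set.uIcc_subset_Icc hu hv)
  have hi : ∀ᶠ δ in 𝓝[>] (0 : ℝ), ω - δ ∈ Set.Icc 0 b ∧ ω + δ ∈ Set.Icc 0 b := by
    filter_upwards [eventually_mem_Ioo_zero hω, eventually_mem_Ioo_zero (sub_pos.2 hb)] with δ h2 h3
    exact ⟨⟨by linarith [h2.2], by linarith [h2.1]⟩, ⟨by linarith [h2.1], by linarith [h3.2]⟩⟩
  have hz : (0 : ℝ) ∈ Set.Icc 0 b := ⟨le_rfl, hb0.le⟩
  have hbb : b ∈ Set.Icc 0 b := ⟨hb0.le, le_rfl⟩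
  rw [hasPVIntegral_coe]
  refine ⟨hi.mono fun δ h => ⟨hsub _ _ hz h.1, hsub _ _ h.2 hbb⟩, ?_⟩
  have hc := intervalIntegral.continuousOn_primitive_interval (f := h) (μ := volume) (a := 0)
    (b := b) (by
      rw [Set.uIcc_of_le hb0.le]
      exact (intervalIntegrable_iff_integrableOn_Icc_of_le hb0.le).1 H)
  rw [Set.uIcc_of_le hb0.le] at hc
  have hca : ContinuousAt (fun x => ∫ t in (0 : ℝ)..x, h t) ω :=
    hc.continuousAt (Icc_mem_nhds hω hb)
  have t1 : Tendsto (fun δ : ℝ => ω - δ) (𝓝[>] 0) (𝓝 ω) := by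
    have : Tendsto (fun δ : ℝ => ω - δ) (𝓝 0) (𝓝 (ω - 0)) :=
      (continuous_const.sub continuous_id).tendsto 0
    rw [sub_zero] at this
    exact this.mono_left nhdsWithin_le_nhds
  have t2 : Tendsto (fun δ : ℝ => ω + δ) (𝓝[>] 0) (𝓝 ω) := by
    have : Tendsto (fun δ : ℝ => ω + δ) (𝓝 0) (𝓝 (ω + 0)) :=
      (continuous_const.add continuous_id).tendsto 0
    rw [add_zero] at this
    exact this.mono_left nhdsWithin_le_nhds
  have := ((hca.tendsto.comp t1).sub (hca.tendsto.comp t2)).add_const (∫ x in (0 : ℝ)..b, h x)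
  rw [sub_self, zero_add] at this
  refine this.congr' ?_
  filter_upwards [hi] with δ h1
  simp only [Function.comp_apply]
  rw [← intervalIntegral.integral_add_adjacent_intervals (hsub _ _ hz h1.2) (hsub _ _ h1.2 hbb)]
  ring

/-! ### Principal values of powers. -/

lemma continuousOn_kernel {φ : ℝ → ℂ} {s : Set ℝ} {ω ν : ℝ} (hν : ν < 1) (hω : 0 < ω)
    (hφ : ContinuousOn φ s) (h0 : ∀ x ∈ s, 0 ≤ x ∧ x ≠ ω) :
    ContinuousOn (fun x : ℝ => ((x ^ (1 - ν) / (ω ^ 2 - x ^ 2) : ℝ) : ℂ) * φ x) s := by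
  refine ContinuousOn.mul (Complex.continuous_ofReal.comp_continuousOn ?_) hφ
  refine ContinuousOn.div (continuousOn_id.rpow_const fun x _ => Or.inr (by linarith))
    (by fun_prop) fun x hx h => ?_
  obtain ⟨h1, h2⟩ := h0 x hx
  rcases mul_eq_zero.1 (show (ω - x) * (ω + x) = 0 by linear_combination h) with h | h
  · exact h2 (by linarith)
  · linarith

lemma hasPVIntegral_pow {ν ω r : ℝ} (hν0 : 0 < ν) (hν1 : ν < 1) (hω : 0 < ω) (hr : ω < r) (n : ℕ) :
    Summable (fun k : ℕ => ω ^ (2 * k) * (r ^ ((n : ℝ) - 2 * k - ν) / ((n : ℝ) - 2 * k - ν))) ∧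
    HasPVIntegral (fun x : ℝ => ((x ^ (1 - ν) / (ω ^ 2 - x ^ 2) : ℝ) : ℂ) * (x : ℂ) ^ n) ω
      (r : WithTop ℝ)
      ((-(∑' k : ℕ, ω ^ (2 * k) * (r ^ ((n : ℝ) - 2 * k - ν) / ((n : ℝ) - 2 * k - ν))) +
        ω ^ ((n : ℝ) - ν) * (Real.pi / 2 * Real.cot (Real.pi * (((n : ℝ) - ν) / 2))) : ℝ) : ℂ) := by
  have hq : ∀ k : ℕ, (n : ℝ) - 2 * k - ν ≠ 0 := fun k h => by
    have := min_le_abs_sub hν0 hν1 n k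
    rw [h, abs_zero] at this
    exact absurd (lt_min hν0 (sub_pos.2 hν1)) this.not_gt
  have hs : ∀ m : ℤ, (n : ℝ) + 2 - ν ≠ 2 * m := fun m h => by
    have h1 : ((n + 2 - 2 * m : ℤ) : ℝ) = ν := by push_cast; linarith
    have h2 : (0 : ℤ) < n + 2 - 2 * m := by exact_mod_cast h1 ▸ hν0
    have h3 : (n + 2 - 2 * m : ℤ) < 1 := by exact_mod_cast h1 ▸ hν1
    omega
  -- The numerator `x ^ (1 - ν) x ^ n` is `x ^ (s - 1)`.
  set s : ℝ := (n : ℝ) + 2 - ν with hsdef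
  have hs1 : 1 < s := by have : (0 : ℝ) ≤ n := n.cast_nonneg; linarith
  -- This series is the termwise antiderivative, up to sign, at an endpoint `u > ω`. At `u = r` it
  -- is the series of finite parts; at `u = ω + δ` it is the second term of the bracket.
  have hQ : ∀ u : ℝ, 0 < u → (∃ q : ℝ, q < 1 ∧ (ω / u) ^ 2 ≤ q) → HasSum
      (fun k : ℕ => ω ^ (2 * k) * (u ^ ((n : ℝ) - 2 * k - ν) / ((n : ℝ) - 2 * k - ν)))
      (-(ω ^ (s - 2) * ((ω / u) ^ (2 - s) * ∑' k : ℕ, ((ω / u) ^ 2) ^ k / (2 * (k : ℝ) + (2 - s))))) := by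
    intro u hu ⟨q, hq1, hqu⟩
    have h := (((summable_pow_div (by positivity) (hqu.trans_lt hq1) (2 - s)).hasSum.mul_left
      ((ω / u) ^ (2 - s))).mul_left (ω ^ (s - 2))).neg
    refine h.congr_fun fun k => ?_
    have e1 : (n : ℝ) - 2 * k - ν = s - 2 - (2 * k : ℕ) := by rw [hsdef]; push_cast; ring
    have e2 : 2 * (k : ℝ) + (2 - s) = -(s - 2 - (2 * k : ℕ)) := by push_cast; ring
    have e3 : s - 2 - ((2 * k : ℕ) : ℝ) ≠ 0 := e1 ▸ hq k
    rw [e2, e1, Real.rpow_sub hu, Real.rpow_natCast, div_neg, Real.div_rpow hω.le hu.le,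
      show 2 - s = -(s - 2) by ring, Real.rpow_neg hω.le, Real.rpow_neg hu.le, ← pow_mul, div_pow]
    have h1 : 0 < ω ^ (s - 2) := Real.rpow_pos_of_pos hω _
    have h2 : 0 < u ^ (s - 2) := Real.rpow_pos_of_pos hu _
    field_simp
  have hlt : ∀ u : ℝ, ω < u → ∃ q : ℝ, q < 1 ∧ (ω / u) ^ 2 ≤ q := fun u hu =>
    ⟨_, pow_lt_one₀ (div_nonneg hω.le (hω.trans hu).le) ((div_lt_one (hω.trans hu)).2 hu)
      two_ne_zero, le_rfl⟩
  have hr0 : 0 < r := hω.trans hr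
  have hQr := (hQ r hr0 (hlt r hr)).summable
  refine ⟨hQr, ?_⟩
  rw [hasPVIntegral_coe]
  have hcont : ContinuousOn (fun x : ℝ => (x : ℂ) ^ n) Set.univ :=
    (Complex.continuous_ofReal.pow n).continuousOn
  have hev : ∀ᶠ δ in 𝓝[>] (0 : ℝ), 0 < δ ∧ 0 < ω - δ ∧ ω + δ < r := by
    filter_upwards [eventually_mem_Ioo_zero hω, eventually_mem_Ioo_zero (sub_pos.2 hr)] with δ h2 h3
    exact ⟨h2.1, by linarith [h2.2], by linarith [h3.2]⟩
  constructor
  · filter_upwards [hev] with δ ⟨h1, h2, h3⟩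
    constructor
    · refine ContinuousOn.intervalIntegrable
        (continuousOn_kernel hν1 hω (hcont.mono (Set.subset_univ _)) fun x hx => ?_)
      rw [Set.uIcc_of_le h2.le] at hx
      exact ⟨hx.1, (by linarith [hx.2] : x < ω).ne⟩
    · refine ContinuousOn.intervalIntegrable
        (continuousOn_kernel hν1 hω (hcont.mono (Set.subset_univ _)) fun x hx => ?_)
      rw [Set.uIcc_of_le h3.le] at hx
      have : ω < x := by linarith [hx.1]
      exact ⟨(hω.trans this).le, this.ne'⟩
  · have hb := ((tendsto_pv_bracket hω hs).const_mul (ω ^ (s - 2))).const_add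
      (-(∑' k : ℕ, ω ^ (2 * k) * (r ^ ((n : ℝ) - 2 * k - ν) / ((n : ℝ) - 2 * k - ν))))
    have e0 : Real.cot (Real.pi * (s / 2)) = Real.cot (Real.pi * (((n : ℝ) - ν) / 2)) := by
      rw [show Real.pi * (s / 2) = Real.pi * (((n : ℝ) - ν) / 2) + Real.pi by rw [hsdef]; ring,
        Real.cot_eq_cos_div_sin, Real.cot_eq_cos_div_sin, Real.cos_add_pi, Real.sin_add_pi, neg_div_neg_eq]
    rw [e0, show s - 2 = (n : ℝ) - ν by rw [hsdef]; ring] at hb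
    refine ((Complex.continuous_ofReal.tendsto _).comp hb).congr' ?_
    filter_upwards [hev] with δ ⟨h1, h2, h3⟩
    have p1 := (hasSum_integral_below hs1 h2 (by linarith : ω - δ < ω)).tsum_eq
    rw [tsum_mul_left, tsum_mul_left] at p1
    have p1' : ∫ x in (0 : ℝ)..(ω - δ), ((x ^ (1 - ν) / (ω ^ 2 - x ^ 2) : ℝ) : ℂ) * (x : ℂ) ^ n =
        ((∫ x in (0 : ℝ)..(ω - δ), x ^ (s - 1) / (ω ^ 2 - x ^ 2) : ℝ) : ℂ) := by
      rw [← intervalIntegral.integral_ofReal]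
      refine intervalIntegral.integral_congr_ae (Eventually.of_forall fun x hx => ?_)
      rw [Set.uIoc_of_le h2.le] at hx
      rw [← Complex.ofReal_pow, ← Complex.ofReal_mul, show s - 1 = 1 - ν + (n : ℝ) by rw [hsdef]; ring,
        Real.rpow_add hx.1, Real.rpow_natCast]
      congr 1
      ring
    have hδ : ω < ω + δ := by linarith
    have hδ0 : 0 < ω + δ := by linarith
    have p2 := hasSum_integral_geometric (ν := ν) hω hδ h3.le (hcont.mono (Set.subset_univ _))
    have p3 := Complex.hasSum_ofReal.2 (hQr.hasSum.sub (hQ (ω + δ) hδ0 (hlt _ hδ)))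
    have p4 := p2.unique (p3.congr_fun fun k => by
      have : ∫ x in (ω + δ)..r, (x : ℂ) ^ n / ((x ^ (2 * (k : ℝ) + ν + 1) : ℝ) : ℂ) =
          ∫ x in (ω + δ)..r, ((x ^ ((n : ℝ) - 2 * k - ν - 1) : ℝ) : ℂ) := by
        refine intervalIntegral.integral_congr_ae (Eventually.of_forall fun x hx => ?_)
        rw [Set.uIoc_of_le h3.le] at hx
        rw [← Complex.ofReal_pow, ← Complex.ofReal_div, ← Real.rpow_natCast,
          ← Real.rpow_sub (hδ0.trans hx.1)]
        congr 2
        ring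
      rw [this, integral_ofReal_rpow hδ0 hr0 (hq k)]
      push_cast
      ring)
    simp only [Function.comp_apply]
    rw [p1', ← p1, ← neg_neg (∫ x in (ω + δ)..r, _), p4, ← Complex.ofReal_neg, ← Complex.ofReal_add,
      show s - 2 = (n : ℝ) - ν by rw [hsdef]; ring]
    congr 1
    ring

/-! ### The expansion on `[0, r]`, by linearity and division by `z ^ 2 - ω ^ 2`. -/

lemma HasSum.congr_all {u v : ℕ → ℂ} {p q : ℂ} (h : HasSum u p) (huv : ∀ k, v k = u k)
    (hpq : q = p) : HasSum v q := by
  rw [hpq, funext huv]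
  exact h

/-- The expansion of the principal value integral over `[0, r]` in finite part integrals. -/
def HasPVExpansion (ν ω r : ℝ) (f : ℂ → ℂ) : Prop :=
  ∃ (I : ℂ) (J : ℕ → ℂ),
    HasPVIntegral (fun x : ℝ => ((x ^ (1 - ν) / (ω ^ 2 - x ^ 2) : ℝ) : ℂ) * f (x : ℂ)) ω
      (r : WithTop ℝ) I ∧
    (∀ k : ℕ, HasFinitePart (fun x : ℝ => f (x : ℂ) / ((x ^ (2 * (k : ℝ) + ν + 1) : ℝ) : ℂ))
      (r : WithTop ℝ) (J k)) ∧
    HasSum (fun k : ℕ => (ω : ℂ) ^ (2 * k) * J k)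
      (-I - ((Real.pi / (2 * ω ^ ν) : ℝ) : ℂ) *
          (f (ω : ℂ) * ((Real.cot (Real.pi * ν) : ℝ) : ℂ)
            + f (-(ω : ℂ)) / ((Real.sin (Real.pi * ν) : ℝ) : ℂ)))

lemma HasPVExpansion.add {ν ω r : ℝ} {f g : ℂ → ℂ} (hω : 0 < ω) (hr : ω < r)
    (hf : HasPVExpansion ν ω r f) (hg : HasPVExpansion ν ω r g) :
    HasPVExpansion ν ω r (fun z => f z + g z) := by
  obtain ⟨I, J, h1, h2, h3⟩ := hf
  obtain ⟨I', J', h1', h2', h3'⟩ := hg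
  refine ⟨I + I', fun k => J k + J' k, (h1.add h1').congr hω hr fun x _ _ => by ring,
    fun k => ((h2 k).add (h2' k)).congr (hω.trans hr) fun x _ => by ring, ?_⟩
  exact (h3.add h3').congr_all (fun k => by ring) (by ring)

lemma HasPVExpansion.const_mul {ν ω r : ℝ} {f : ℂ → ℂ} (hω : 0 < ω) (hr : ω < r) (c : ℂ)
    (hf : HasPVExpansion ν ω r f) : HasPVExpansion ν ω r (fun z => c * f z) := by
  obtain ⟨I, J, h1, h2, h3⟩ := hf
  refine ⟨c * I, fun k => c * J k, (h1.const_mul c).congr hω hr fun x _ _ => by ring,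
    fun k => ((h2 k).const_mul c).congr (hω.trans hr) fun x _ => by ring, ?_⟩
  exact (h3.mul_left c).congr_all (fun k => by ring) (by ring)

lemma cot_add_inv_sin {y : ℝ} (hs : Real.sin (y / 2) ≠ 0) (hc : Real.cos (y / 2) ≠ 0) :
    Real.cot y + 1 / Real.sin y = Real.cot (y / 2) := by
  have e : y = 2 * (y / 2) := by ring
  rw [Real.cot_eq_cos_div_sin, Real.cot_eq_cos_div_sin]
  nth_rw 1 2 3 [e]
  rw [Real.cos_two_mul, Real.sin_two_mul]
  field_simp
  ring

lemma cot_sub_inv_sin {y : ℝ} (hs : Real.sin (y / 2) ≠ 0) (hc : Real.cos (y / 2) ≠ 0) :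
    Real.cot y - 1 / Real.sin y = -Real.tan (y / 2) := by
  have e : y = 2 * (y / 2) := by ring
  rw [Real.cot_eq_cos_div_sin, Real.tan_eq_sin_div_cos]
  nth_rw 1 2 3 [e]
  rw [Real.cos_two_mul, Real.sin_two_mul]
  field_simp
  linear_combination 2 * Real.sin_sq_add_cos_sq (y / 2)

lemma sin_half_ne_zero {ν : ℝ} (hν0 : 0 < ν) (hν1 : ν < 1) : Real.sin (Real.pi * ν / 2) ≠ 0 :=
  (Real.sin_pos_of_pos_of_lt_pi (by positivity) (by nlinarith [Real.pi_pos])).ne'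

lemma cos_half_ne_zero {ν : ℝ} (hν0 : 0 < ν) (hν1 : ν < 1) : Real.cos (Real.pi * ν / 2) ≠ 0 :=
  (Real.cos_pos_of_mem_Ioo ⟨by nlinarith [Real.pi_pos, mul_pos Real.pi_pos hν0],
    by nlinarith [Real.pi_pos]⟩).ne'

/-- The identity `hcot` depends only on the parity of `n`; it is needed, and verified by half-angle
formulas, only for `n = 0` and `n = 1`. -/
lemma HasPVExpansion.of_hasPVIntegral_pow {ν ω r : ℝ} (hν0 : 0 < ν) (hν1 : ν < 1) (hω : 0 < ω)
    (hr : ω < r) (n : ℕ)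
    (hcot : Real.cot (Real.pi * (((n : ℝ) - ν) / 2)) =
      -(Real.cot (Real.pi * ν) + (-1) ^ n * (1 / Real.sin (Real.pi * ν)))) :
    HasPVExpansion ν ω r (fun z => z ^ n) := by
  have hr0 := hω.trans hr
  obtain ⟨hs, hpv⟩ := hasPVIntegral_pow hν0 hν1 hω hr n
  have hq : ∀ k : ℕ, (n : ℝ) - 2 * k - ν ≠ 0 := fun k h => by
    have := min_le_abs_sub hν0 hν1 n k
    rw [h, abs_zero] at this
    exact absurd (lt_min hν0 (sub_pos.2 hν1)) this.not_gt
  refine ⟨_, fun k => ((r ^ ((n : ℝ) - 2 * k - ν) / ((n : ℝ) - 2 * k - ν) : ℝ) : ℂ), hpv,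
    fun k => (hasFinitePart_rpow hr0 (hq k)).congr hr0 fun x hx => ?_, ?_⟩
  · beta_reduce
    rw [← Complex.ofReal_pow, ← Complex.ofReal_div, ← Real.rpow_natCast, ← Real.rpow_sub hx.1]
    congr 2
    ring
  · refine (Complex.hasSum_ofReal.2 hs.hasSum).congr_all (fun k => ?_) ?_
    · push_cast
      ring
    · beta_reduce
      rw [hcot, Real.rpow_sub hω, Real.rpow_natCast, neg_pow (ω : ℂ)]
      push_cast
      have h1 : ((ω ^ ν : ℝ) : ℂ) ≠ 0 := by exact_mod_cast (Real.rpow_pos_of_pos hω ν).ne'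
      field_simp
      ring

lemma hasPVExpansion_one {ν ω r : ℝ} (hν0 : 0 < ν) (hν1 : ν < 1) (hω : 0 < ω) (hr : ω < r) :
    HasPVExpansion ν ω r (fun _ => 1) := by
  have := HasPVExpansion.of_hasPVIntegral_pow hν0 hν1 hω hr 0 (by
    rw [pow_zero, one_mul, cot_add_inv_sin (sin_half_ne_zero hν0 hν1) (cos_half_ne_zero hν0 hν1),
      Nat.cast_zero, show Real.pi * ((0 - ν) / 2) = -(Real.pi * ν / 2) by ring,
      Real.cot_eq_cos_div_sin, Real.cot_eq_cos_div_sin, Real.cos_neg, Real.sin_neg, div_neg])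
  simpa using this

lemma hasPVExpansion_id {ν ω r : ℝ} (hν0 : 0 < ν) (hν1 : ν < 1) (hω : 0 < ω) (hr : ω < r) :
    HasPVExpansion ν ω r (fun z => z) := by
  have := HasPVExpansion.of_hasPVIntegral_pow hν0 hν1 hω hr 1 (by
    rw [pow_one, neg_one_mul, ← sub_eq_add_neg,
      cot_sub_inv_sin (sin_half_ne_zero hν0 hν1) (cos_half_ne_zero hν0 hν1),
      Nat.cast_one, show Real.pi * ((1 - ν) / 2) = Real.pi / 2 - Real.pi * ν / 2 by ring,
      Real.cot_eq_cos_div_sin, Real.cos_pi_div_two_sub, Real.sin_pi_div_two_sub, neg_neg,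
      Real.tan_eq_sin_div_cos])
  simpa using this

lemma hasPVExpansion_sq_sub_mul {ν ω r R : ℝ} (hν0 : 0 < ν) (hν1 : ν < 1) (hω : 0 < ω) (hr : ω < r)
    (hR : r < R) {g : ℂ → ℂ} (hg : DifferentiableOn ℂ g (Metric.ball 0 R)) :
    HasPVExpansion ν ω r (fun z => (z ^ 2 - (ω : ℂ) ^ 2) * g z) := by
  have hr0 : 0 < r := hω.trans hr
  obtain ⟨C, hC⟩ := exists_hasFinitePart_of_differentiableOn hν0 hν1 hr0 hR hg
  choose J hJ hJC using hC
  have hgc : ContinuousOn (fun x : ℝ => ((x ^ (1 - ν) : ℝ) : ℂ) * g (x : ℂ)) (Set.uIcc 0 r) := by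
    rw [Set.uIcc_of_le hr0.le]
    refine ContinuousOn.mul (Complex.continuous_ofReal.comp_continuousOn
      (continuousOn_id.rpow_const fun x _ => Or.inr (by linarith)))
      (hg.continuousOn.comp Complex.continuous_ofReal.continuousOn fun x hx => ?_)
    simpa [abs_of_nonneg hx.1] using hx.2.trans_lt hR
  have hgi := hgc.intervalIntegrable (μ := volume)
  set L := ∫ x in (0 : ℝ)..r, ((x ^ (1 - ν) : ℝ) : ℂ) * g (x : ℂ) with hL
  -- `Jm k` is the finite part for `x ^ 2 g`: the factor `x ^ 2` lowers the index by one, and at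
  -- index `0` the integral converges.
  let Jm : ℕ → ℂ := fun k => Nat.casesOn k L J
  have hJm : ∀ k : ℕ, HasFinitePart
      (fun x : ℝ => ((x ^ 2 : ℝ) : ℂ) * (g (x : ℂ) / ((x ^ (2 * (k : ℝ) + ν + 1) : ℝ) : ℂ)))
      (r : WithTop ℝ) (Jm k) := by
    intro k
    rcases k with _ | k
    · refine (hgi.hasFinitePart hr0).congr hr0 fun x hx => ?_
      rw [show 1 - ν = (2 : ℕ) - (2 * ((0 : ℕ) : ℝ) + ν + 1) by push_cast; ring,
        Real.rpow_sub hx.1, Real.rpow_natCast]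
      push_cast
      ring
    · refine (hJ k).congr hr0 fun x hx => ?_
      have hx0 : (x : ℂ) ≠ 0 := by exact_mod_cast hx.1.ne'
      rw [show 2 * ((k + 1 : ℕ) : ℝ) + ν + 1 = (2 * (k : ℝ) + ν + 1) + (2 : ℕ) by push_cast; ring,
        Real.rpow_add hx.1 _ ((2 : ℕ) : ℝ), Real.rpow_natCast]
      push_cast
      field_simp
  have hsT : Summable fun k : ℕ => (ω : ℂ) ^ (2 * k) * Jm k := by
    rw [← summable_nat_add_iff 1]
    have hq1 : (ω / r) ^ 2 < 1 := pow_lt_one₀ (by positivity) ((div_lt_one hr0).2 hr) two_ne_zero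
    refine ((summable_geometric_of_lt_one (by positivity) hq1).mul_left
      (ω ^ 2 * C)).of_norm_bounded fun k => ?_
    have h1 : ‖J k‖ ≤ C / r ^ (2 * k) := (le_div_iff₀ (by positivity)).2 (hJC k)
    calc ‖(ω : ℂ) ^ (2 * (k + 1)) * J k‖ = ω ^ (2 * (k + 1)) * ‖J k‖ := by
          rw [norm_mul, norm_pow, Complex.norm_real, Real.norm_of_nonneg hω.le]
      _ ≤ ω ^ (2 * (k + 1)) * (C / r ^ (2 * k)) := by gcongr
      _ = _ := by
          rw [← pow_mul, div_pow, mul_add, pow_add]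
          ring
  -- After multiplication by `ω ^ (2 k)` these coefficients telescope, with sum `Jm 0 = L`.
  refine ⟨-L, fun k => Jm k - (ω : ℂ) ^ 2 * Jm (k + 1), ?_, ?_, ?_⟩
  · have := (hgi.hasPVIntegral hω hr).const_mul (-1)
    rw [neg_one_mul] at this
    refine this.congr hω hr fun x hx0 hxω => ?_
    have h1 : ((ω : ℂ) ^ 2 - (x : ℂ) ^ 2) ≠ 0 := by
      intro h
      have h' : (ω - x) * (ω + x) = 0 := by
        have : ω ^ 2 - x ^ 2 = 0 := by exact_mod_cast h
        linear_combination this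
      rcases mul_eq_zero.1 h' with h | h
      · exact hxω (by linarith)
      · linarith
    push_cast
    field_simp
    ring
  · intro k
    have h := (hJm k).add ((hJ k).const_mul (-(ω : ℂ) ^ 2))
    rw [neg_mul, ← sub_eq_add_neg] at h
    refine h.congr hr0 fun x _ => ?_
    push_cast
    ring
  · have h1 := hsT.hasSum.sub ((hasSum_nat_add_iff' 1).2 hsT.hasSum)
    exact h1.congr_all (fun k => by ring) (by simp [Jm])

lemma hasPVExpansion_of_differentiableOn {ν ω r R : ℝ} (hν0 : 0 < ν) (hν1 : ν < 1) (hω : 0 < ω)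
    (hr : ω < r) (hR : r < R) {f : ℂ → ℂ} (hf : DifferentiableOn ℂ f (Metric.ball 0 R)) :
    HasPVExpansion ν ω r f := by
  have hωR : ω < R := hr.trans hR
  have h1 : Metric.ball (0 : ℂ) R ∈ 𝓝 (ω : ℂ) :=
    Metric.isOpen_ball.mem_nhds (by simpa [abs_of_pos hω] using hωR)
  have h2 : Metric.ball (0 : ℂ) R ∈ 𝓝 (-(ω : ℂ)) :=
    Metric.isOpen_ball.mem_nhds (by simpa [abs_of_pos hω] using hωR)
  set g := dslope f ω with hg
  have hgd : DifferentiableOn ℂ g (Metric.ball 0 R) := (Complex.differentiableOn_dslope h1).2 hf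
  have hg2 : DifferentiableOn ℂ (dslope g (-ω)) (Metric.ball 0 R) :=
    (Complex.differentiableOn_dslope h2).2 hgd
  -- Newton interpolation at `ω` and `-ω`: substitute `g = g (-ω) + (z + ω) * dslope g (-ω)` into `f
  -- = f ω + (z - ω) * g`.
  have e : f = fun z => ((f ω - ω * g (-ω)) * 1 + g (-ω) * z) +
      (z ^ 2 - (ω : ℂ) ^ 2) * dslope g (-ω) z := by
    funext z
    have e1 := sub_smul_dslope f (ω : ℂ) z
    have e2 := sub_smul_dslope g (-ω : ℂ) z
    simp only [smul_eq_mul] at e1 e2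
    rw [← hg] at e1
    linear_combination -e1 - (z - ω) * e2
  rw [e]
  exact (((hasPVExpansion_one hν0 hν1 hω hr).const_mul hω hr _).add hω hr
    ((hasPVExpansion_id hν0 hν1 hω hr).const_mul hω hr _)).add hω hr
    (hasPVExpansion_sq_sub_mul hν0 hν1 hω hr hR hg2)

/-! ### Tails at infinity for conditionally convergent integrals. -/

lemma exists_norm_integral_le {φ : ℝ → ℂ} {r : ℝ} (hφ : ContinuousOn φ (Set.Ici r)) {L : ℂ}
    (hL : Tendsto (fun b => ∫ x in r..b, φ x) atTop (𝓝 L)) :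
    ∃ M : ℝ, ∀ b, r ≤ b → ‖∫ x in r..b, φ x‖ ≤ M := by
  obtain ⟨B, hB⟩ := eventually_atTop.1 (hL.norm.eventually (gt_mem_nhds (lt_add_one ‖L‖)))
  have hB' : r ≤ max B r := le_max_right _ _
  have hc : ContinuousOn (fun b => ∫ x in r..b, φ x) (Set.Icc r (max B r)) := by
    have := intervalIntegral.continuousOn_primitive_interval (f := φ) (μ := volume) (a := r)
      (b := max B r) (by
        rw [Set.uIcc_of_le hB']
        exact (hφ.mono Set.Icc_subset_Ici_self).integrableOn_Icc)
    rwa [Set.uIcc_of_le hB'] at this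
  obtain ⟨C, hC⟩ := isCompact_Icc.exists_bound_of_continuousOn hc
  refine ⟨max C (‖L‖ + 1), fun b hb => ?_⟩
  rcases le_total b (max B r) with h | h
  · exact (hC b ⟨hb, h⟩).trans (le_max_left _ _)
  · exact (hB b ((le_max_left _ _).trans h)).le.trans (le_max_right _ _)

lemma continuousOn_integral_Ici {φ : ℝ → ℂ} {r : ℝ} (hφ : ContinuousOn φ (Set.Ici r)) :
    ContinuousOn (fun b => ∫ x in r..b, φ x) (Set.Ici r) := by
  intro b hb
  have hb' : r ≤ b + 1 := by linarith [Set.mem_Ici.1 hb]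
  have := intervalIntegral.continuousOn_primitive_interval (f := φ) (μ := volume) (a := r)
    (b := b + 1) (by
      rw [Set.uIcc_of_le hb']
      exact (hφ.mono Set.Icc_subset_Ici_self).integrableOn_Icc)
  rw [Set.uIcc_of_le hb'] at this
  refine (this b ⟨hb, by linarith⟩).mono_of_mem_nhdsWithin ?_
  have : Set.Ici r ∩ Set.Iio (b + 1) ∈ 𝓝[Set.Ici r] b :=
    inter_mem_nhdsWithin _ (Iio_mem_nhds (by linarith))
  exact mem_of_superset this fun x hx => ⟨hx.1, (Set.mem_Iio.1 hx.2).le⟩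

/-- Integration by parts against a decreasing weight. -/
lemma integral_mul_weight {φ : ℝ → ℂ} {r b : ℝ} (hb : r ≤ b) (hφ : ContinuousOn φ (Set.Ici r))
    {w w' : ℝ → ℝ} (hw : ∀ x ∈ Set.Ici r, HasDerivAt w (w' x) x)
    (hw' : ContinuousOn w' (Set.Ici r)) :
    ∫ x in r..b, φ x * (w x : ℂ) =
      (∫ x in r..b, φ x) * (w b : ℂ) - ∫ x in r..b, (∫ t in r..x, φ t) * (w' x : ℂ) := by
  have hΦ := continuousOn_integral_Ici hφ
  have hwc : ContinuousOn (fun x => (w x : ℂ)) (Set.Ici r) :=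
    Complex.continuous_ofReal.comp_continuousOn fun x hx => (hw x hx).continuousAt.continuousWithinAt
  have hwc' : ContinuousOn (fun x => (w' x : ℂ)) (Set.Ici r) :=
    Complex.continuous_ofReal.comp_continuousOn hw'
  have hsub : Set.uIcc r b ⊆ Set.Ici r := by
    rw [Set.uIcc_of_le hb]; exact Set.Icc_subset_Ici_self
  have i1 : IntervalIntegrable (fun x => φ x * (w x : ℂ)) volume r b :=
    ((hφ.mul hwc).mono hsub).intervalIntegrable
  have i2 : IntervalIntegrable (fun x => (∫ t in r..x, φ t) * (w' x : ℂ)) volume r b :=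
    ((hΦ.mul hwc').mono hsub).intervalIntegrable
  have h := intervalIntegral.integral_eq_sub_of_hasDerivAt_of_le hb
    (f := fun x => (∫ t in r..x, φ t) * (w x : ℂ))
    (f' := fun x => φ x * (w x : ℂ) + (∫ t in r..x, φ t) * (w' x : ℂ))
    ((hΦ.mul hwc).mono Set.Icc_subset_Ici_self) (fun x hx => ?_) (i1.add i2)
  · rw [intervalIntegral.integral_add i1 i2, intervalIntegral.integral_same, zero_mul, sub_zero] at h
    rw [← h]
    ring
  · have hφx : ContinuousOn φ (Set.Ioi r) := hφ.mono Set.Ioi_subset_Ici_self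
    have d1 : HasDerivAt (fun x => ∫ t in r..x, φ t) (φ x) x :=
      intervalIntegral.integral_hasDerivAt_right
        (hφ.mono (by rw [Set.uIcc_of_le hx.1.le]; exact Set.Icc_subset_Ici_self)).intervalIntegrable
        (hφx.stronglyMeasurableAtFilter isOpen_Ioi x hx.1)
        (hφx.continuousAt (isOpen_Ioi.mem_nhds hx.1))
    exact d1.mul (hw x hx.1.le).ofReal_comp

/-- If the primitive is bounded by `M` and the weight `w = x ^ (-2 k)` is nonincreasing, integration
by parts gives at most `M w(b) + M (w(r) - w(b)) = M w(r)`. No factor growing with `k` is lost, so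
the bound sums geometrically against `ω ^ (2 k)`. -/
lemma exists_norm_integral_div_pow_le {φ : ℝ → ℂ} {r : ℝ} (hr : 0 < r)
    (hφ : ContinuousOn φ (Set.Ici r)) {L : ℂ}
    (hL : Tendsto (fun b => ∫ x in r..b, φ x) atTop (𝓝 L)) :
    ∃ M : ℝ, ∀ k : ℕ, (∀ b, r ≤ b → ‖∫ x in r..b, φ x / (x : ℂ) ^ (2 * k)‖ ≤ M / r ^ (2 * k)) ∧
      ∃ L' : ℂ, Tendsto (fun b => ∫ x in r..b, φ x / (x : ℂ) ^ (2 * k)) atTop (𝓝 L') := by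
  obtain ⟨M, hM⟩ := exists_norm_integral_le hφ hL
  refine ⟨M, fun k => ?_⟩
  set w : ℝ → ℝ := fun x => (x ^ (2 * k))⁻¹ with hwdef
  -- For `k = 0` the truncated exponent `2 * k - 1` is harmless, as the factor `2 * k` vanishes.
  set w' : ℝ → ℝ := fun x => -(((2 * k : ℕ) : ℝ) * x ^ (2 * k - 1)) / (x ^ (2 * k)) ^ 2 with hw'def
  have hpos : ∀ x ∈ Set.Ici r, 0 < x := fun x hx => hr.trans_le hx
  have hw : ∀ x ∈ Set.Ici r, HasDerivAt w (w' x) x := fun x hx =>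
    (hasDerivAt_pow (2 * k) x).inv (pow_pos (hpos x hx) _).ne'
  have hw'c : ContinuousOn w' (Set.Ici r) := by
    refine ContinuousOn.div (by fun_prop) (by fun_prop) fun x hx => ?_
    have := hpos x hx
    positivity
  have hw'0 : ∀ x ∈ Set.Ici r, w' x ≤ 0 := fun x hx => by
    have := hpos x hx
    change -(((2 * k : ℕ) : ℝ) * x ^ (2 * k - 1)) / (x ^ (2 * k)) ^ 2 ≤ 0
    rw [neg_div]
    exact neg_nonpos.2 (by positivity)
  have hwl : ∃ l : ℝ, Tendsto w atTop (𝓝 l) := by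
    rcases Nat.eq_zero_or_pos k with rfl | hk
    · exact ⟨1, by simp [hwdef]⟩
    · exact ⟨0, tendsto_inv_atTop_zero.comp (tendsto_pow_atTop (by omega))⟩
  obtain ⟨l, hl⟩ := hwl
  have heq : ∀ b, r ≤ b → ∫ x in r..b, φ x / (x : ℂ) ^ (2 * k) =
      (∫ x in r..b, φ x) * (w b : ℂ) - ∫ x in r..b, (∫ t in r..x, φ t) * (w' x : ℂ) := by
    intro b hb
    rw [← integral_mul_weight hb hφ hw hw'c]
    simp only [hwdef, div_eq_mul_inv, Complex.ofReal_inv, Complex.ofReal_pow]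
  have hΦ := continuousOn_integral_Ici hφ
  have hbd : ∀ x ∈ Set.Ici r, ‖(∫ t in r..x, φ t) * (w' x : ℂ)‖ ≤ -(M * w' x) := fun x hx => by
    rw [norm_mul, Complex.norm_real, Real.norm_of_nonpos (hw'0 x hx), ← mul_neg]
    exact mul_le_mul_of_nonneg_right (hM x hx) (neg_nonneg.2 (hw'0 x hx))
  constructor
  · intro b hb
    have hwb : 0 ≤ w b := by
      have := hpos b hb
      positivity
    have hi : IntervalIntegrable w' volume r b :=
      (hw'c.mono (by rw [Set.uIcc_of_le hb]; exact Set.Icc_subset_Ici_self)).intervalIntegrable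
    have h1 := intervalIntegral.norm_integral_le_of_norm_le hb
      (Eventually.of_forall fun x hx => hbd x (Set.mem_Ici.2 hx.1.le)) (hi.const_mul M).neg
    have h2 : ∫ x in r..b, w' x = w b - w r :=
      intervalIntegral.integral_eq_sub_of_hasDerivAt (fun x hx => hw x (by
        rw [Set.uIcc_of_le hb] at hx; exact hx.1)) hi
    rw [intervalIntegral.integral_neg, intervalIntegral.integral_const_mul, h2] at h1
    have h3 : ‖(∫ x in r..b, φ x) * (w b : ℂ)‖ ≤ M * w b := by
      rw [norm_mul, Complex.norm_real, Real.norm_of_nonneg hwb]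
      exact mul_le_mul_of_nonneg_right (hM b hb) hwb
    rw [heq b hb, div_eq_mul_inv]
    refine (norm_sub_le _ _).trans ((add_le_add h3 h1).trans (le_of_eq ?_))
    ring
  · have hint : IntegrableOn w' (Set.Ioi r) :=
      integrableOn_Ioi_deriv_of_nonpos (hw r Set.self_mem_Ici).continuousAt.continuousWithinAt
        (fun x hx => hw x (Set.mem_Ici.2 (le_of_lt hx)))
        (fun x hx => hw'0 x (Set.mem_Ici.2 (le_of_lt hx))) hl
    have hint2 : IntegrableOn (fun x => (∫ t in r..x, φ t) * (w' x : ℂ)) (Set.Ioi r) := by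
      refine (hint.const_mul M).neg.mono' ?_ ?_
      · refine ContinuousOn.aestronglyMeasurable ?_ measurableSet_Ioi
        exact (hΦ.mul (Complex.continuous_ofReal.comp_continuousOn hw'c)).mono
          Set.Ioi_subset_Ici_self
      · refine (ae_restrict_iff' measurableSet_Ioi).2 (Eventually.of_forall fun x hx => ?_)
        exact hbd x (Set.mem_Ici.2 (le_of_lt hx))
    refine ⟨_, ((hL.mul ((Complex.continuous_ofReal.tendsto l).comp hl)).sub
      (intervalIntegral_tendsto_integral_Ioi r hint2 tendsto_id)).congr' ?_⟩
    filter_upwards [eventually_ge_atTop r] with b hb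
    exact (heq b hb).symm

lemma HasPVIntegral.unique {h : ℝ → ℂ} {b ω : ℝ} {L L' : ℂ}
    (H : HasPVIntegral h ω (b : WithTop ℝ) L) (H' : HasPVIntegral h ω (b : WithTop ℝ) L') :
    L = L' :=
  tendsto_nhds_unique (hasPVIntegral_coe.1 H).2 (hasPVIntegral_coe.1 H').2

lemma HasFinitePart.congr_pos {h h' : ℝ → ℂ} {a : WithTop ℝ} (ha : 0 < a) {L : ℂ}
    (H : HasFinitePart h a L) (heq : ∀ x, 0 < x → h x = h' x) : HasFinitePart h' a L := by
  induction a using WithTop.recTopCoe with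
  | top =>
    obtain ⟨v, hv, hL⟩ := H
    refine ⟨v, ?_, hL⟩
    filter_upwards [hv, eventually_gt_atTop 0] with b hb hb0
    exact HasFinitePart.congr hb0 hb fun x hx => heq x hx.1
  | coe a => exact H.congr (by exact_mod_cast ha) fun x hx => heq x hx.1

lemma tendsto_integral_of_integrableAtFilter {φ : ℝ → ℂ} {r : ℝ}
    (hφ : ContinuousOn φ (Set.Ici r)) (h : IntegrableAtFilter φ atTop volume) :
    ∃ L : ℂ, Tendsto (fun b => ∫ x in r..b, φ x) atTop (𝓝 L) := by
  obtain ⟨s, hs, hi⟩ := h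
  obtain ⟨B, hB⟩ := mem_atTop_sets.1 hs
  have h1 : IntegrableOn φ (Set.Ioi (max B r)) :=
    hi.mono_set fun x hx => hB x ((le_max_left _ _).trans (le_of_lt hx))
  have h2 : IntegrableOn φ (Set.Icc r (max B r)) :=
    (hφ.mono Set.Icc_subset_Ici_self).integrableOn_Icc
  refine ⟨_, intervalIntegral_tendsto_integral_Ioi r ((h2.union h1).mono_set fun x hx => ?_)
    tendsto_id⟩
  rcases le_or_gt x (max B r) with h | h
  · exact Or.inl ⟨le_of_lt hx, h⟩
  · exact Or.inr h

/-- If the principal value integral over `[0, ∞)` converges, so does the tail of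
`∫ f x / x ^ (ν + 1)`. -/
lemma tendsto_integral_of_kernel {φ : ℝ → ℂ} {r ω ν : ℝ} (hν1 : ν < 1) (hω : 0 < ω) (hr : ω < r)
    (hφ : ContinuousOn φ (Set.Ici r)) {L : ℂ}
    (hL : Tendsto (fun b => ∫ x in r..b, ((x ^ (1 - ν) / (ω ^ 2 - x ^ 2) : ℝ) : ℂ) * φ x)
      atTop (𝓝 L)) :
    ∃ L' : ℂ, Tendsto (fun b => ∫ x in r..b, φ x / ((x ^ (ν + 1) : ℝ) : ℂ)) atTop (𝓝 L') := by
  have hr0 := hω.trans hr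
  have hk := continuousOn_kernel (ν := ν) hν1 hω hφ fun x hx =>
    ⟨hr0.le.trans hx, (hr.trans_le hx).ne'⟩
  have hk2 : ContinuousOn (fun x : ℝ => ((x ^ (1 - ν) / (ω ^ 2 - x ^ 2) : ℝ) : ℂ) * φ x /
      (x : ℂ) ^ (2 * 1)) (Set.Ici r) := by
    refine hk.div (by fun_prop) fun x hx => ?_
    exact pow_ne_zero _ (by exact_mod_cast (hr0.trans_le hx).ne')
  obtain ⟨M, hM⟩ := exists_norm_integral_div_pow_le hr0 hk hL
  obtain ⟨-, L', hL'⟩ := hM 1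
  -- With `K` the kernel times `φ`, one has `φ / x ^ (ν + 1) = ω ^ 2 K / x ^ 2 - K`, and both
  -- integrals on the right converge.
  refine ⟨_, ((hL'.const_mul ((ω : ℂ) ^ 2)).sub hL).congr' ?_⟩
  filter_upwards [eventually_ge_atTop r] with b hb
  have hsub : Set.uIcc r b ⊆ Set.Ici r := by
    rw [Set.uIcc_of_le hb]; exact Set.Icc_subset_Ici_self
  rw [← intervalIntegral.integral_const_mul, ← intervalIntegral.integral_sub
    ((hk2.mono hsub).intervalIntegrable.const_mul _) (hk.mono hsub).intervalIntegrable]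
  refine intervalIntegral.integral_congr_ae (Eventually.of_forall fun x hx => ?_)
  rw [Set.uIoc_of_le hb] at hx
  have hx0 : 0 < x := hr0.trans hx.1
  have h2 : x ^ (1 - ν) = x ^ 2 / x ^ (ν + 1) := by
    rw [← Real.rpow_natCast, ← Real.rpow_sub hx0]
    congr 1
    push_cast
    ring
  have h3 : (((ω ^ 2 - x ^ 2 : ℝ)) : ℂ) ≠ 0 := by
    have : ω < x := hr.trans hx.1
    exact_mod_cast (by nlinarith : ω ^ 2 - x ^ 2 < 0).ne
  have h4 : ((x ^ (ν + 1) : ℝ) : ℂ) ≠ 0 := by exact_mod_cast (Real.rpow_pos_of_pos hx0 _).ne'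
  have h5 : (x : ℂ) ≠ 0 := by exact_mod_cast hx0.ne'
  rw [h2]
  push_cast at h3 ⊢
  field_simp

/-! ### From `[0, r]` to `[0, a]`, finite or infinite. -/

lemma exists_expansion {ν ω : ℝ} (hν0 : 0 < ν) (hν1 : ν < 1) {a : WithTop ℝ} {f : ℂ → ℂ}
    (hf : ComplexAnalyticUpTo f a) (hω : 0 < ω) (hωa : (ω : WithTop ℝ) < a)
    (hωρ : ENNReal.ofReal ω < singularityDist f)
    (hinf : a = ⊤ →
      (∃ L : ℂ, HasPVIntegral
        (fun x : ℝ => ((x ^ (1 - ν) / (ω ^ 2 - x ^ 2) : ℝ) : ℂ) * f (x : ℂ)) ω a L) ∨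
      IntegrableAtFilter (fun x : ℝ => f (x : ℂ) * ((x ^ (-1 - ν) : ℝ) : ℂ)) atTop volume) :
    ∃ (I : ℂ) (J : ℕ → ℂ),
      HasPVIntegral
        (fun x : ℝ => ((x ^ (1 - ν) / (ω ^ 2 - x ^ 2) : ℝ) : ℂ) * f (x : ℂ)) ω a I ∧
      (∀ k : ℕ, HasFinitePart
        (fun x : ℝ => f (x : ℂ) / ((x ^ (2 * (k : ℝ) + ν + 1) : ℝ) : ℂ)) a (J k)) ∧
      HasSum (fun k : ℕ => (ω : ℂ) ^ (2 * k) * J k)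
        (-I - ((Real.pi / (2 * ω ^ ν) : ℝ) : ℂ) *
          (f (ω : ℂ) * ((Real.cot (Real.pi * ν) : ℝ) : ℂ)
            + f (-(ω : ℂ)) / ((Real.sin (Real.pi * ν) : ℝ) : ℂ))) := by
  obtain ⟨R, -, hωR, hRρ⟩ := ENNReal.lt_iff_exists_real_btwn.1 hωρ
  have hR : ω < R := (ENNReal.ofReal_lt_ofReal_iff_of_nonneg hω.le).1 hωR
  have hd : DifferentiableOn ℂ f (Metric.ball 0 R) := by
    intro z hz
    have : AnalyticAt ℂ f z := by
      by_contra hna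
      have h1 : singularityDist f ≤ edist 0 z := Metric.infEDist_le_edist_of_mem hna
      have h2 : edist 0 z < ENNReal.ofReal R := by
        rw [edist_comm]
        exact edist_lt_ofReal.2 (Metric.mem_ball.1 hz)
      exact absurd (h1.trans_lt (h2.trans hRρ)) (lt_irrefl _)
    exact this.differentiableAt.differentiableWithinAt
  have hfc : ∀ x : ℝ, 0 ≤ x → (x : WithTop ℝ) ≤ a → ContinuousAt (fun x : ℝ => f (x : ℂ)) x :=
    fun x hx hxa => ContinuousAt.comp (f := fun x : ℝ => (x : ℂ)) (hf x hx hxa).continuousAt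
      Complex.continuous_ofReal.continuousAt
  obtain ⟨r, hr, hrR, hra⟩ : ∃ r : ℝ, ω < r ∧ r < R ∧ (r : WithTop ℝ) ≤ a := by
    induction a using WithTop.recTopCoe with
    | top => exact ⟨(ω + R) / 2, by linarith, by linarith, le_top⟩
    | coe a =>
      have hωa' : ω < a := by exact_mod_cast hωa
      exact ⟨min a ((ω + R) / 2), lt_min hωa' (by linarith),
        (min_le_right _ _).trans_lt (by linarith), by exact_mod_cast min_le_left _ _⟩
  have hr0 : 0 < r := hω.trans hr
  obtain ⟨I, J, hI, hJ, hsum⟩ := hasPVExpansion_of_differentiableOn hν0 hν1 hω hr hrR hd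
  have hcIcc : ∀ b : ℝ, (b : WithTop ℝ) ≤ a → ContinuousOn (fun x : ℝ => f (x : ℂ)) (Set.Icc r b) :=
    fun b hb x hx => (hfc x (hr0.le.trans hx.1)
      ((WithTop.coe_le_coe.2 hx.2).trans hb)).continuousWithinAt
  have hpvb : ∀ b : ℝ, r ≤ b → (b : WithTop ℝ) ≤ a → HasPVIntegral
      (fun x : ℝ => ((x ^ (1 - ν) / (ω ^ 2 - x ^ 2) : ℝ) : ℂ) * f (x : ℂ)) ω (b : WithTop ℝ)
      (I + ∫ x in r..b, ((x ^ (1 - ν) / (ω ^ 2 - x ^ 2) : ℝ) : ℂ) * f (x : ℂ)) := by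
    intro b hb hba
    refine hI.extend (ContinuousOn.intervalIntegrable ?_)
    rw [Set.uIcc_of_le hb]
    exact continuousOn_kernel hν1 hω (hcIcc b hba) fun x hx =>
      ⟨hr0.le.trans hx.1, (hr.trans_le hx.1).ne'⟩
  have hfpb : ∀ (k : ℕ) (b : ℝ), r ≤ b → (b : WithTop ℝ) ≤ a → HasFinitePart
      (fun x : ℝ => f (x : ℂ) / ((x ^ (2 * (k : ℝ) + ν + 1) : ℝ) : ℂ)) (b : WithTop ℝ)
      (J k + ∫ x in r..b, f (x : ℂ) / ((x ^ (2 * (k : ℝ) + ν + 1) : ℝ) : ℂ)) := by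
    intro k b hb hba
    refine (hJ k).extend (ContinuousOn.intervalIntegrable ?_)
    rw [Set.uIcc_of_le hb]
    exact continuousOn_div_rpow (hcIcc b hba) (fun x hx => hr0.trans_le hx.1) _
  have hsb : ∀ b : ℝ, r ≤ b → (b : WithTop ℝ) ≤ a → _ := fun b hb hba =>
    hasSum_integral_geometric (ν := ν) hω hr hb (hcIcc b hba)
  induction a using WithTop.recTopCoe with
  | coe a =>
    have hra' : r ≤ a := by exact_mod_cast hra
    exact ⟨_, _, hpvb a hra' le_rfl, fun k => hfpb k a hra' le_rfl,
      (hsum.add (hsb a hra' le_rfl)).congr_all (fun k => by ring) (by ring)⟩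
  | top =>
    have hcI : ContinuousOn (fun x : ℝ => f (x : ℂ)) (Set.Ici r) := fun x hx =>
      (hfc x (hr0.le.trans hx) le_top).continuousWithinAt
    have hφc : ContinuousOn (fun x : ℝ => f (x : ℂ) / ((x ^ (ν + 1) : ℝ) : ℂ)) (Set.Ici r) :=
      continuousOn_div_rpow hcI (fun x hx => hr0.trans_le hx) _
    -- Both alternatives at infinity are reduced to this one condition.
    have hconv : ∃ L : ℂ, Tendsto
        (fun b => ∫ x in r..b, f (x : ℂ) / ((x ^ (ν + 1) : ℝ) : ℂ)) atTop (𝓝 L) := by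
      rcases hinf rfl with ⟨L, v, hv, hL⟩ | hi
      · refine tendsto_integral_of_kernel (L := L - I) hν1 hω hr hcI ?_
        refine (hL.sub_const I).congr' ?_
        filter_upwards [hv, eventually_ge_atTop r] with b hb hrb
        rw [HasPVIntegral.unique hb (hpvb b hrb le_top), add_sub_cancel_left]
      · refine tendsto_integral_of_integrableAtFilter hφc ?_
        obtain ⟨s, hs, hi⟩ := hi
        obtain ⟨B, hB⟩ := mem_atTop_sets.1 hs
        refine ⟨Set.Ici (max B 0), Ici_mem_atTop _, ?_⟩
        refine (hi.mono_set fun x hx => hB x ((le_max_left _ _).trans hx)).congr_fun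
          (fun x hx => ?_) measurableSet_Ici
        have hx0 : 0 ≤ x := (le_max_right _ _).trans hx
        beta_reduce
        rw [show -1 - ν = -(ν + 1) by ring, Real.rpow_neg hx0, div_eq_mul_inv, Complex.ofReal_inv]
    obtain ⟨L, hL⟩ := hconv
    obtain ⟨M, hM⟩ := exists_norm_integral_div_pow_le hr0 hφc hL
    have hKeq : ∀ (k : ℕ) (b : ℝ), r ≤ b →
        ∫ x in r..b, f (x : ℂ) / ((x ^ (2 * (k : ℝ) + ν + 1) : ℝ) : ℂ) =
        ∫ x in r..b, f (x : ℂ) / ((x ^ (ν + 1) : ℝ) : ℂ) / (x : ℂ) ^ (2 * k) := by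
      intro k b hb
      refine intervalIntegral.integral_congr_ae (Eventually.of_forall fun x hx => ?_)
      rw [Set.uIoc_of_le hb] at hx
      rw [show 2 * (k : ℝ) + ν + 1 = (ν + 1) + ((2 * k : ℕ) : ℝ) by push_cast; ring,
        Real.rpow_add (hr0.trans hx.1), Real.rpow_natCast, div_div]
      push_cast
      rfl
    choose K hK using fun k => (hM k).2
    have hq1 : (ω / r) ^ 2 < 1 := pow_lt_one₀ (by positivity) ((div_lt_one hr0).2 hr) two_ne_zero
    have hgeo : Summable fun k : ℕ => M * ((ω / r) ^ 2) ^ k :=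
      (summable_geometric_of_lt_one (by positivity) hq1).mul_left M
    have hbound : ∀ (k : ℕ) (b : ℝ), r ≤ b → ‖(ω : ℂ) ^ (2 * k) *
        ∫ x in r..b, f (x : ℂ) / ((x ^ (ν + 1) : ℝ) : ℂ) / (x : ℂ) ^ (2 * k)‖ ≤
        M * ((ω / r) ^ 2) ^ k := by
      intro k b hb
      rw [norm_mul, norm_pow, Complex.norm_real, Real.norm_of_nonneg hω.le]
      calc _ ≤ ω ^ (2 * k) * (M / r ^ (2 * k)) := by
            gcongr
            exact (hM k).1 b hb
        _ = _ := by rw [← pow_mul, div_pow]; ring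
    have hKt : ∀ k : ℕ, Tendsto (fun b => (ω : ℂ) ^ (2 * k) *
        ∫ x in r..b, f (x : ℂ) / ((x ^ (ν + 1) : ℝ) : ℂ) / (x : ℂ) ^ (2 * k)) atTop
        (𝓝 ((ω : ℂ) ^ (2 * k) * K k)) := fun k => (hK k).const_mul _
    have hKs : Summable fun k : ℕ => (ω : ℂ) ^ (2 * k) * K k :=
      hgeo.of_norm_bounded fun k => le_of_tendsto (hKt k).norm
        ((eventually_ge_atTop r).mono fun b hb => hbound k b hb)
    -- The limit `b → ∞` passes through the sum over `k` because `hbound` is uniform in `b`.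
    have hT := tendsto_tsum_of_dominated_convergence hgeo hKt
      ((eventually_ge_atTop r).mono fun b hb k => hbound k b hb)
    have hH : Tendsto (fun b => ∫ x in r..b, ((x ^ (1 - ν) / (ω ^ 2 - x ^ 2) : ℝ) : ℂ) * f (x : ℂ))
        atTop (𝓝 (-∑' k : ℕ, (ω : ℂ) ^ (2 * k) * K k)) := by
      refine hT.neg.congr' ?_
      filter_upwards [eventually_ge_atTop r] with b hb
      rw [← neg_neg (∫ x in r..b, ((x ^ (1 - ν) / (ω ^ 2 - x ^ 2) : ℝ) : ℂ) * f (x : ℂ)),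
        ← (hsb b hb le_top).tsum_eq]
      simp only [hKeq _ b hb]
    refine ⟨I + -∑' k : ℕ, (ω : ℂ) ^ (2 * k) * K k, fun k => J k + K k,
      ⟨_, (eventually_ge_atTop r).mono fun b hb => hpvb b hb le_top, hH.const_add I⟩,
      fun k => ⟨_, (eventually_ge_atTop r).mono fun b hb => hfpb k b hb le_top, ?_⟩,
      (hsum.add hKs.hasSum).congr_all (fun k => by ring) (by ring)⟩
    refine ((hK k).const_add (J k)).congr' ?_
    filter_upwards [eventually_ge_atTop r] with b hb
    rw [hKeq k b hb]

/-! ### The general formula and its two special cases. -/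

lemma intervalIntegrable_rpow_mul {g : ℂ → ℂ} {b q : ℝ} (hq : -1 < q) (hb : 0 < b)
    (hg : ∀ x ∈ Set.Icc 0 b, ContinuousAt g ((x : ℝ) : ℂ)) :
    IntervalIntegrable (fun x : ℝ => ((x ^ q : ℝ) : ℂ) * g (x : ℂ)) volume 0 b := by
  have h : IntervalIntegrable (fun x : ℝ => x ^ q) volume 0 b :=
    intervalIntegral.intervalIntegrable_rpow' hq
  have h' : IntervalIntegrable (fun x : ℝ => ((x ^ q : ℝ) : ℂ)) volume 0 b :=
    ⟨h.1.ofReal, h.2.ofReal⟩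
  refine h'.mul_continuousOn fun x hx => ?_
  rw [Set.uIcc_of_le hb.le] at hx
  exact (ContinuousAt.comp (f := fun x : ℝ => (x : ℂ)) (hg x hx)
    Complex.continuous_ofReal.continuousAt).continuousWithinAt

theorem theorem5p4 (ν : ℝ) (hν0 : 0 < ν) (hν1 : ν < 1)
    (a : WithTop ℝ) (f : ℂ → ℂ) (hf : ComplexAnalyticUpTo f a)
    (ω : ℝ) (hω0 : 0 < ω) (hωa : (ω : WithTop ℝ) < a)
    (hωρ : ENNReal.ofReal ω < singularityDist f)
    (hinf : a = ⊤ →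
      (∃ L : ℂ, HasPVIntegral
        (fun x : ℝ => ((x ^ (1 - ν) / (ω ^ 2 - x ^ 2) : ℝ) : ℂ) * f (x : ℂ)) ω a L) ∨
      IntegrableAtFilter (fun x : ℝ => f (x : ℂ) * ((x ^ (-1 - ν) : ℝ) : ℂ)) atTop volume) :
    ∃ (I : ℂ) (J : ℕ → ℂ),
      HasPVIntegral
        (fun x : ℝ => ((x ^ (1 - ν) / (ω ^ 2 - x ^ 2) : ℝ) : ℂ) * f (x : ℂ)) ω a I ∧
      (∀ k : ℕ, HasFinitePart
        (fun x : ℝ => f (x : ℂ) / ((x ^ (2 * (k : ℝ) + ν + 1) : ℝ) : ℂ)) a (J k)) ∧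
      Summable (fun k : ℕ => (ω : ℂ) ^ (2 * k) * J k) ∧
      -- the general formula
      I = -(∑' k : ℕ, (ω : ℂ) ^ (2 * k) * J k)
        - ((Real.pi / (2 * ω ^ ν) : ℝ) : ℂ) *
          (f (ω : ℂ) * ((Real.cot (Real.pi * ν) : ℝ) : ℂ)
            + f (-(ω : ℂ)) / ((Real.sin (Real.pi * ν) : ℝ) : ℂ)) ∧
      -- the case of even `f`
      ((∀ x : ℝ, ENNReal.ofReal |x| < singularityDist f → f (-(x : ℂ)) = f (x : ℂ)) →
        I = -(∑' k : ℕ, (ω : ℂ) ^ (2 * k) * J k)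
          - ((Real.pi / 2 : ℝ) : ℂ) * (f (ω : ℂ) / ((ω ^ ν : ℝ) : ℂ)) *
            ((Real.cot (Real.pi * ν / 2) : ℝ) : ℂ)) ∧
      -- the case `f(x) = x ^ m g(x)`; the finite sum runs over `0 ≤ k ≤ ⌊(m - 1) / 2⌋`
      (∀ (m : ℕ) (g : ℂ → ℂ), 1 ≤ m → AnalyticAt ℂ g 0 → (∀ z : ℂ, f z = z ^ m * g z) →
        ∃ A B : ℕ → ℂ,
          (∀ k ∈ Finset.range ((m - 1) / 2 + 1), HasIntegral
            (fun x : ℝ => ((x ^ ((m : ℝ) - 2 * (k : ℝ) - ν - 1) : ℝ) : ℂ) * g (x : ℂ)) a (A k)) ∧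
          (∀ k : ℕ, HasFinitePart
            (fun x : ℝ => (x : ℂ) ^ m * g (x : ℂ) /
              ((x ^ (2 * (k : ℝ) + 2 * (((m + 1) / 2 : ℕ) : ℝ) + ν + 1) : ℝ) : ℂ)) a (B k)) ∧
          Summable (fun k : ℕ => (ω : ℂ) ^ (2 * k + 2 * ((m + 1) / 2)) * B k) ∧
          I = -(∑ k ∈ Finset.range ((m - 1) / 2 + 1), (ω : ℂ) ^ (2 * k) * A k)
            - (∑' k : ℕ, (ω : ℂ) ^ (2 * k + 2 * ((m + 1) / 2)) * B k)
            - ((Real.pi * ω ^ ((m : ℝ) - ν) / 2 : ℝ) : ℂ) *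
              (g (ω : ℂ) * ((Real.cot (Real.pi * ν) : ℝ) : ℂ)
                + (-1) ^ m * g (-(ω : ℂ)) / ((Real.sin (Real.pi * ν) : ℝ) : ℂ))) := by
  obtain ⟨I, J, hI, hJ, hsum⟩ := exists_expansion hν0 hν1 hf hω0 hωa hωρ hinf
  have ha : 0 < a := lt_trans (by exact_mod_cast hω0) hωa
  have hgen : I = -(∑' k : ℕ, (ω : ℂ) ^ (2 * k) * J k)
      - ((Real.pi / (2 * ω ^ ν) : ℝ) : ℂ) *
        (f (ω : ℂ) * ((Real.cot (Real.pi * ν) : ℝ) : ℂ)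
          + f (-(ω : ℂ)) / ((Real.sin (Real.pi * ν) : ℝ) : ℂ)) := by
    rw [hsum.tsum_eq]
    ring
  refine ⟨I, J, hI, hJ, hsum.summable, hgen, fun heven => ?_, fun m g hm hg hfg => ?_⟩
  · rw [hgen, heven ω (by rwa [abs_of_pos hω0]),
      ← cot_add_inv_sin (sin_half_ne_zero hν0 hν1) (cos_half_ne_zero hν0 hν1)]
    push_cast
    ring
  · have hs' : Summable fun k : ℕ => (ω : ℂ) ^ (2 * k + 2 * ((m + 1) / 2)) * J (k + (m + 1) / 2) :=
      ((summable_nat_add_iff ((m + 1) / 2)).2 hsum.summable).congr fun k => by rw [mul_add]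
    -- Analyticity of `g` is given at `0` only; elsewhere continuity comes from `g = f / z ^ m`.
    have hgc : ∀ x : ℝ, 0 ≤ x → (x : WithTop ℝ) ≤ a → ContinuousAt g (x : ℂ) := by
      intro x hx hxa
      rcases hx.eq_or_lt with rfl | hx
      · simpa using hg.continuousAt
      · have hx0 : (x : ℂ) ≠ 0 := by exact_mod_cast hx.ne'
        have h1 : ContinuousAt (fun z => f z / z ^ m) (x : ℂ) :=
          (hf x hx.le hxa).continuousAt.div (by fun_prop) (pow_ne_zero m hx0)
        refine h1.congr ?_
        filter_upwards [isOpen_ne.mem_nhds hx0] with z hz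
        rw [hfg z, mul_div_cancel_left₀ _ (pow_ne_zero m hz)]
    -- Both families are the same sequence `J`, cut at index `(m + 1) / 2`. Below the cut `2 k + 1 ≤
    -- m`, so the exponent of `x` is at least `-ν > -1` and the integral converges at `0`.
    refine ⟨J, fun k => J (k + (m + 1) / 2), fun k hk => ?_, fun k => ?_, hs', ?_⟩
    · have hk' : 2 * k + 1 ≤ m := by
        have := Finset.mem_range.1 hk
        omega
      have hk'' : 2 * (k : ℝ) + 1 ≤ m := by exact_mod_cast hk'
      refine HasFinitePart.hasIntegral ha (fun b hb hba => ?_) ((hJ k).congr_pos ha fun x hx => ?_)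
      · exact intervalIntegrable_rpow_mul (by linarith) hb fun x hx =>
          hgc x hx.1 ((WithTop.coe_le_coe.2 hx.2).trans hba)
      · rw [hfg, show (m : ℝ) - 2 * k - ν - 1 = m - (2 * (k : ℝ) + ν + 1) by ring,
          Real.rpow_sub hx, Real.rpow_natCast]
        push_cast
        ring
    · refine (hJ (k + (m + 1) / 2)).congr_pos ha fun x hx => ?_
      rw [hfg, Nat.cast_add, mul_add]
    · have hsplit := hsum.summable.sum_add_tsum_nat_add ((m + 1) / 2)
      have e1 : (m - 1) / 2 + 1 = (m + 1) / 2 := by omega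
      have e2 : ∑' k : ℕ, (ω : ℂ) ^ (2 * k + 2 * ((m + 1) / 2)) * J (k + (m + 1) / 2) =
          ∑' k : ℕ, (ω : ℂ) ^ (2 * (k + (m + 1) / 2)) * J (k + (m + 1) / 2) := by
        simp only [mul_add]
      rw [e1, e2, hgen, ← hsplit, hfg, hfg (-ω), Real.rpow_sub hω0, Real.rpow_natCast,
        neg_pow (ω : ℂ)]
      push_cast
      ring
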